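/- Let $n\ge 0$ and $d\ge 2$ be integers and let $G$ be a linear Lie group, i.e. a closed subgroup of $GL(n,\mathbb R)$, with Lie algebra $\mathrm{Lie}(G)=\{A\in\mathbb R^{n\times n}:\exp(tA)\in G\ \text{for all } t\in\mathbb R\}$. Matrices carry the norm induced by the Euclidean norm, and for $\|E-I_n\|<1$ let $\log E=\sum_{k\ge1}\frac{(-1)^{k+1}}{k}(E-I_n)^k$ be the principal logarithm. For a smooth, uniformly bounded, locally Lipschitz input $u:\mathbb R\to\mathrm{Lie}(G)$ consider, for $t\ge 0$, the system on $G\times\mathrm{Lie}(G)^{d-1}$ $$\dot X=Xx_2,\quad \dot x_i=x_{i+1}\ (2\le i<d),\quad \dot x_d=u,\qquad Y=X .$$ Let $a_0,\dots,a_{d-1}\in\mathbb R$ be such that all complex roots of $s^d+a_{d-1}s^{d-1}+\dots+a_1s+a_0$ have negative real part, and consider the direct partial state observer $$\dot{\hat X}=Y\hat x_2Y^{-1}\hat X-a_{d-1}\hat X\log(Y^{-1}\hat X),\quad \dot{\hat x}_i=\hat x_{i+1}-a_{d-i}\log(Y^{-1}\hat X)\ (2\le i<d),\quad \dot{\hat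 x}_d=u-a_0\log(Y^{-1}\hat X),$$ whose solutions are required to satisfy $\|Y^{-1}\hat X-I_n\|<1$. Put $E_l=X^{-1}\hat X$, $e_i=x_i-\hat x_i$ $(2\le i\le d)$, and $$\rho(t)=\|E_l(t)-I_n\|+\sum_{i=2}^d\|e_i(t)\|,\qquad \eta(t)=\|\hat X(t)-X(t)\|+\sum_{i=2}^d\|\hat x_i(t)-x_i(t)\| .$$ Then there is $\alpha>0$ such that the following two statements hold. (1) The observer locally exponentially stabilizes $(E_l,e_2,\dots,e_d)=(I_n,0_n,\dots,0_n)$: there are $\delta,m>0$ such that for every such input $u$, every solution $(X,x_2,\dots,x_d)$ of the system, and every initial estimate $(\hat X(0),\hat x_2(0),\dots,\hat x_d(0))\in G\times\mathrm{Lie}(G)^{d-1}$ with $\rho(0)<\delta$, the observer has a unique solution; it exists for all $t\ge0$, stays in $G\times\mathrm{Lie}(G)^{d-1}$, and satisfies $\rho(t)\le m e^{-\alpha t}\rho(0)$ for all $t\ge 0$. (2) Suppose that the input $u$ is such that for every initial condition in $G\times\mathrm{Lie}(G)^{d-1}$ the component $X(t)$ of the corresponding solution of the system is bounded on $[0,\infty)$.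 Then for every solution $(X,x_2,\dots,x_d)$ of the system with this input there are $\varepsilon,C>0$ such that for every initial estimate in $G\times\mathrm{Lie}(G)^{d-1}$ with $\eta(0)<\varepsilon$ the observer has a unique solution; it exists for all $t\ge0$, stays in $G\times\mathrm{Lie}(G)^{d-1}$, and satisfies $\eta(t)\le C e^{-\alpha t}\eta(0)$ for all $t\ge 0$. -/

import Mathlib

open scoped Matrix.Norms.L2Operator ContDiff

noncomputable section

namespace PartialStateObserver

/-- Real `n × n` matrices. They carry the norm induced by the Euclidean norm on `ℝⁿ`
(opened above through `Matrix.Norms.L2Operator`). -/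
abbrev Mat (n : ℕ) : Type := Matrix (Fin n) (Fin n) ℝ

/-- The elements of a subgroup `G` of `GL(n, ℝ)`, seen as matrices. -/
def groupSet {n : ℕ} (G : Subgroup (Matrix.GeneralLinearGroup (Fin n) ℝ)) : Set (Mat n) :=
  {A | ∃ g ∈ G, (g : Mat n) = A}

/-- The Lie algebra of `G`: the matrices `A` with `exp (t A) ∈ G` for all real `t`. -/
def lieSet {n : ℕ} (G : Subgroup (Matrix.GeneralLinearGroup (Fin n) ℝ)) : Set (Mat n) :=
  {A | ∀ t : ℝ, NormedSpace.exp (t • A) ∈ groupSet G}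

/-- The principal logarithm, through its power series
`log X = ∑_{k ≥ 1} (-1)^(k+1) / k • (X - 1)^k` (here the index is shifted by one).
It is only used for `‖X - 1‖ < 1`, where the series converges absolutely. -/
def matLog {n : ℕ} (X : Mat n) : Mat n :=
  ∑' k : ℕ, ((-1 : ℝ) ^ k / ((k : ℝ) + 1)) • (X - 1) ^ (k + 1)

/-- A real polynomial is Hurwitz if all its complex roots have negative real part. -/
def IsHurwitz (p : Polynomial ℝ) : Prop :=
  ∀ z : ℂ, Polynomial.aeval z p = 0 → z.re < 0

/-- The polynomial `s^d + a_{d-1} s^{d-1} + ⋯ + a_1 s + a_0`. -/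
def gainPolynomial (d : ℕ) (a : ℕ → ℝ) : Polynomial ℝ :=
  Polynomial.X ^ d + ∑ i ∈ Finset.range d, Polynomial.C (a i) * Polynomial.X ^ i

/-- Input signals: curves in the Lie algebra of `G` that are smooth, uniformly bounded and
locally Lipschitz. -/
structure IsInput {n : ℕ} (G : Subgroup (Matrix.GeneralLinearGroup (Fin n) ℝ))
    (u : ℝ → Mat n) : Prop where
  mem_lie : ∀ t, u t ∈ lieSet G
  smooth : ContDiff ℝ ∞ u
  bounded : ∃ M : ℝ, ∀ t, ‖u t‖ ≤ M
  locallyLipschitz : LocallyLipschitz u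

/-- `(X, x₂, …, x_d)` is a solution, for `t ≥ 0`, of
`X' = X x₂`, `x₂' = x₃`, …, `x_{d-1}' = x_d`, `x_d' = u` in `G × Lie(G) × ⋯ × Lie(G)`.
Only the components `x i` with `2 ≤ i ≤ d` matter. -/
structure IsPlantTrajectory {n : ℕ} (G : Subgroup (Matrix.GeneralLinearGroup (Fin n) ℝ))
    (d : ℕ) (u : ℝ → Mat n) (X : ℝ → Mat n) (x : ℕ → ℝ → Mat n) : Prop where
  mem_group : ∀ t, 0 ≤ t → X t ∈ groupSet G
  mem_lie : ∀ i, 2 ≤ i → i ≤ d → ∀ t, 0 ≤ t → x i t ∈ lieSet G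
  deriv_group : ∀ t, 0 ≤ t → HasDerivWithinAt X (X t * x 2 t) (Set.Ici 0) t
  deriv_lie : ∀ i, 2 ≤ i → i < d → ∀ t, 0 ≤ t →
    HasDerivWithinAt (x i) (x (i + 1) t) (Set.Ici 0) t
  deriv_last : ∀ t, 0 ≤ t → HasDerivWithinAt (x d) (u t) (Set.Ici 0) t

/-- The boundedness assumption on the input `u`: for every initial condition, the component
`X` of the corresponding solution is bounded. -/
def BoundedResponse {n : ℕ} (G : Subgroup (Matrix.GeneralLinearGroup (Fin n) ℝ))
    (d : ℕ) (u : ℝ → Mat n) : Prop :=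
  ∀ (X : ℝ → Mat n) (x : ℕ → ℝ → Mat n), IsPlantTrajectory G d u X x →
    ∃ K : ℝ, ∀ t, 0 ≤ t → ‖X t‖ ≤ K

/-- `(Xh, xh₂, …, xh_d)` solves the direct observer equations with measured output `Y` and
input `u` on the time set `J`:
`Xh' = Y xh₂ Y⁻¹ Xh - a_{d-1} Xh log(Y⁻¹ Xh)`,
`xh_i' = xh_{i+1} - a_{d-i} log(Y⁻¹ Xh)` for `2 ≤ i < d`, and
`xh_d' = u - a_0 log(Y⁻¹ Xh)`.
A solution has to stay in the set `‖Y⁻¹ Xh - 1‖ < 1`, on which the logarithm is defined. -/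
structure IsDirectObserverOn {n : ℕ} (J : Set ℝ) (d : ℕ) (a : ℕ → ℝ) (Y u : ℝ → Mat n)
    (Xh : ℝ → Mat n) (xh : ℕ → ℝ → Mat n) : Prop where
  mem_ball : ∀ t ∈ J, ‖(Y t)⁻¹ * Xh t - 1‖ < 1
  deriv_group : ∀ t ∈ J, HasDerivWithinAt Xh
    (Y t * xh 2 t * (Y t)⁻¹ * Xh t - a (d - 1) • (Xh t * matLog ((Y t)⁻¹ * Xh t))) J t
  deriv_lie : ∀ i, 2 ≤ i → i < d → ∀ t ∈ J, HasDerivWithinAt (xh i)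
    (xh (i + 1) t - a (d - i) • matLog ((Y t)⁻¹ * Xh t)) J t
  deriv_last : ∀ t ∈ J, HasDerivWithinAt (xh d)
    (u t - a 0 • matLog ((Y t)⁻¹ * Xh t)) J t

/-- `(Xh, xh₂, …, xh_d)` is the response of the direct observer to the initial estimate
`(Xh0, xh0₂, …, xh0_d)`: it is a solution for all `t ≥ 0`, it stays in
`G × Lie(G) × ⋯ × Lie(G)`, it has the prescribed initial value, and every matrix-valued
solution with this initial value, on any interval `[0, T)`, coincides with it there. -/
structure IsObserverResponse {n : ℕ} (G : Subgroup (Matrix.GeneralLinearGroup (Fin n) ℝ))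
    (d : ℕ) (a : ℕ → ℝ) (Y u : ℝ → Mat n) (Xh0 : Mat n) (xh0 : ℕ → Mat n)
    (Xh : ℝ → Mat n) (xh : ℕ → ℝ → Mat n) : Prop where
  solution : IsDirectObserverOn (Set.Ici 0) d a Y u Xh xh
  mem_group : ∀ t, 0 ≤ t → Xh t ∈ groupSet G
  mem_lie : ∀ i, 2 ≤ i → i ≤ d → ∀ t, 0 ≤ t → xh i t ∈ lieSet G
  init_group : Xh 0 = Xh0
  init_lie : ∀ i, 2 ≤ i → i ≤ d → xh i 0 = xh0 i
  unique : ∀ (T : ℝ) (Zh : ℝ → Mat n) (zh : ℕ → ℝ → Mat n),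
    IsDirectObserverOn (Set.Ico 0 T) d a Y u Zh zh → Zh 0 = Xh0 →
    (∀ i, 2 ≤ i → i ≤ d → zh i 0 = xh0 i) →
    ∀ t ∈ Set.Ico 0 T, Zh t = Xh t ∧ ∀ i, 2 ≤ i → i ≤ d → zh i t = xh i t

/-- Distance of the error `(E_l, e₂, …, e_d)`, where `E_l = X⁻¹ Xh` and `e_i = x_i - xh_i`,
from `(1, 0, …, 0)`. -/
def groupError {n : ℕ} (d : ℕ) (X : Mat n) (x : ℕ → Mat n) (Xh : Mat n) (xh : ℕ → Mat n) : ℝ :=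
  ‖X⁻¹ * Xh - 1‖ + ∑ i ∈ Finset.Icc 2 d, ‖x i - xh i‖

/-- Size of the estimation error: `‖Xh - X‖ + ‖xh₂ - x₂‖ + ⋯ + ‖xh_d - x_d‖`. -/
def estimationError {n : ℕ} (d : ℕ) (X : Mat n) (x : ℕ → Mat n) (Xh : Mat n)
    (xh : ℕ → Mat n) : ℝ :=
  ‖Xh - X‖ + ∑ i ∈ Finset.Icc 2 d, ‖xh i - x i‖

/-- The direct observer locally exponentially stabilizes `(E_l, e₂, …, e_d) = (1, 0, …, 0)`
with rate `α`; the constants are uniform in the input and in the trajectory of the system. -/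
def LocallyExpStabilizes {n : ℕ} (G : Subgroup (Matrix.GeneralLinearGroup (Fin n) ℝ))
    (d : ℕ) (a : ℕ → ℝ) (α : ℝ) : Prop :=
  ∃ δ > 0, ∃ m > 0, ∀ u : ℝ → Mat n, IsInput G u →
    ∀ (X : ℝ → Mat n) (x : ℕ → ℝ → Mat n), IsPlantTrajectory G d u X x →
    ∀ (Xh0 : Mat n) (xh0 : ℕ → Mat n), Xh0 ∈ groupSet G →
    (∀ i, 2 ≤ i → i ≤ d → xh0 i ∈ lieSet G) →
    groupError d (X 0) (fun i => x i 0) Xh0 xh0 < δ →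
    ∃ (Xh : ℝ → Mat n) (xh : ℕ → ℝ → Mat n),
      IsObserverResponse G d a X u Xh0 xh0 Xh xh ∧
      ∀ t, 0 ≤ t → groupError d (X t) (fun i => x i t) (Xh t) (fun i => xh i t) ≤
        m * Real.exp (-α * t) * groupError d (X 0) (fun i => x i 0) Xh0 xh0

/-- The direct observer solves, for the input `u` and with rate `α`, the partial state
estimation problem: if the initial estimate is close enough to the initial state, then the
estimate in `G × Lie(G) × ⋯ × Lie(G)` converges exponentially to the state. -/
def SolvesEstimation {n : ℕ} (G : Subgroup (Matrix.GeneralLinearGroup (Fin n) ℝ))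
    (d : ℕ) (a : ℕ → ℝ) (α : ℝ) (u : ℝ → Mat n) : Prop :=
  ∀ (X : ℝ → Mat n) (x : ℕ → ℝ → Mat n), IsPlantTrajectory G d u X x →
    ∃ ε > 0, ∃ C > 0, ∀ (Xh0 : Mat n) (xh0 : ℕ → Mat n), Xh0 ∈ groupSet G →
    (∀ i, 2 ≤ i → i ≤ d → xh0 i ∈ lieSet G) →
    estimationError d (X 0) (fun i => x i 0) Xh0 xh0 < ε →
    ∃ (Xh : ℝ → Mat n) (xh : ℕ → ℝ → Mat n),
      IsObserverResponse G d a X u Xh0 xh0 Xh xh ∧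
      ∀ t, 0 ≤ t → estimationError d (X t) (fun i => x i t) (Xh t) (fun i => xh i t) ≤
        C * Real.exp (-α * t) * estimationError d (X 0) (fun i => x i 0) Xh0 xh0

end PartialStateObserver

end

/-!
The left-invariant error `E = X⁻¹ Xh` and the differences `xh_i - x_i` satisfy an autonomous system,
whose linearization at `(1, 0, …, 0)` has the characteristic polynomial
`s^d + a_{d-1} s^{d-1} + ⋯ + a_0` (`aeval_errorOperator`). So the rate and the constants of the
stabilization depend neither on the trajectory nor on the input, and three things have to be shown.

*Decay.* For a product `∏ (s - l)` of linear factors with `Re l < 0` that annihilates an operator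
there is an explicit norm which decreases to first order along the linear flow
(`exists_contracting_seminorm`). A comparison of this norm with a decreasing exponential
(`seminorm_le_exp_mul`) transfers the decay to the nonlinear system: the nonlinear remainder only
has to be estimated at times when the solution lies near the origin.

*Invariance.* A curve whose logarithmic derivative is tangent to `G` stays in the closure of `G`
(`mem_closure_of_hasDerivWithinAt`), by a Grönwall inequality for the distance to `G`. The same
lemma shows that the Lie algebra is closed under addition (`lieSubmodule`). Near the identity the
logarithm maps `G` into its Lie algebra (`eventually_matLog_mem_lieSet`).

*Existence and uniqueness.* The vector field is modified by a projection onto the Lie algebra and a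
cut-off; the modified field is bounded and Lipschitz, hence has global solutions, which remain in
the closure of `G` and, by the decay estimate, in the region where the modification has no
effect (`exists_errorSolution`). Uniqueness follows from the Lipschitz estimate for the logarithm on
balls of radius less than `1` (`errorSolution_unique`).

Boundedness of `X` makes `‖Xh - X‖ = ‖X (E - 1)‖` comparable with `‖E - 1‖`, which turns the
stabilization result into the estimation result (`LocallyExpStabilizes.solvesEstimation`).
-/

namespace PartialStateObserver

open Filter Topology Set Metric

/-! ### The principal logarithm -/

section Logarithm

variable {n : ℕ}

/-- The case `n = 0`, `k = 0`, where `‖1‖ = 0`, is not excluded. -/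
lemma norm_pow_le_pow_norm (ξ : Mat n) (k : ℕ) : ‖ξ ^ k‖ ≤ ‖ξ‖ ^ k := by
  rcases Nat.eq_zero_or_pos k with rfl | hk
  · rw [pow_zero, pow_zero, ← Matrix.diagonal_one, Matrix.l2_opNorm_diagonal]
    exact (pi_norm_const_le (1 : ℝ)).trans (by simp)
  · exact norm_pow_le' ξ hk

lemma norm_one_le : ‖(1 : Mat n)‖ ≤ 1 := by simpa using norm_pow_le_pow_norm (1 : Mat n) 0

lemma norm_logTerm_le (ξ : Mat n) (k : ℕ) :
    ‖((-1 : ℝ) ^ k / ((k : ℝ) + 1)) • ξ ^ (k + 1)‖ ≤ ‖ξ‖ ^ (k + 1) := by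
  rw [norm_smul]
  have h1 : ‖((-1 : ℝ) ^ k / ((k : ℝ) + 1))‖ ≤ 1 := by
    rw [norm_div, norm_pow, norm_neg, norm_one, one_pow, Real.norm_of_nonneg (by positivity)]
    exact div_le_one_of_le₀ (by linarith [k.cast_nonneg (α := ℝ)]) (by positivity)
  calc _ ≤ 1 * ‖ξ‖ ^ (k + 1) := by
        gcongr
        exact norm_pow_le_pow_norm ξ _
    _ = _ := one_mul _

lemma summable_logTerm {ξ : Mat n} (h : ‖ξ‖ < 1) :
    Summable fun k : ℕ => ((-1 : ℝ) ^ k / ((k : ℝ) + 1)) • ξ ^ (k + 1) :=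
  .of_norm_bounded ((summable_nat_add_iff 1).2 (summable_geometric_of_lt_one (norm_nonneg _) h))
    (norm_logTerm_le ξ)

lemma matLog_one_add (ξ : Mat n) :
    matLog (1 + ξ) = ∑' k : ℕ, ((-1 : ℝ) ^ k / ((k : ℝ) + 1)) • ξ ^ (k + 1) := by
  simp [matLog]

lemma norm_matLog_one_add_sub_le {ξ : Mat n} (h : ‖ξ‖ < 1) :
    ‖matLog (1 + ξ) - ξ‖ ≤ ‖ξ‖ ^ 2 * (1 - ‖ξ‖)⁻¹ := by
  rw [matLog_one_add, (summable_logTerm h).tsum_eq_zero_add]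
  have hs : HasSum (fun k : ℕ => ‖ξ‖ ^ 2 * ‖ξ‖ ^ k) (‖ξ‖ ^ 2 * (1 - ‖ξ‖)⁻¹) :=
    (hasSum_geometric_of_lt_one (norm_nonneg _) h).mul_left _
  have := tsum_of_norm_bounded hs fun k => (norm_logTerm_le ξ (k + 1)).trans_eq (by ring)
  simpa using this

lemma norm_pow_sub_pow_le {ξ η : Mat n} {r : ℝ} (hξ : ‖ξ‖ ≤ r) (hη : ‖η‖ ≤ r) (k : ℕ) :
    ‖ξ ^ (k + 1) - η ^ (k + 1)‖ ≤ (k + 1) * r ^ k * ‖ξ - η‖ := by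
  have hr : 0 ≤ r := (norm_nonneg _).trans hξ
  induction k with
  | zero => simp
  | succ k ih =>
    have e : ξ ^ (k + 1 + 1) - η ^ (k + 1 + 1)
        = (ξ ^ (k + 1) - η ^ (k + 1)) * ξ + η ^ (k + 1) * (ξ - η) := by
      rw [pow_succ ξ (k + 1), pow_succ η (k + 1)]; noncomm_ring
    calc _ ≤ ‖ξ ^ (k + 1) - η ^ (k + 1)‖ * ‖ξ‖ + ‖η ^ (k + 1)‖ * ‖ξ - η‖ := by
          rw [e]; exact (norm_add_le _ _).trans (add_le_add (norm_mul_le _ _) (norm_mul_le _ _))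
      _ ≤ ((k + 1) * r ^ k * ‖ξ - η‖) * r + r ^ (k + 1) * ‖ξ - η‖ := by
          gcongr
          exact (norm_pow_le_pow_norm η _).trans (by gcongr)
      _ = _ := by push_cast; ring

lemma norm_matLog_sub_matLog_le {ξ η : Mat n} {r : ℝ} (hr : r < 1) (hξ : ‖ξ‖ ≤ r)
    (hη : ‖η‖ ≤ r) :
    ‖matLog (1 + ξ) - matLog (1 + η)‖ ≤ (1 - r)⁻¹ * ‖ξ - η‖ := by
  have hr0 : 0 ≤ r := (norm_nonneg _).trans hξ
  rw [matLog_one_add, matLog_one_add, ← (summable_logTerm (hξ.trans_lt hr)).tsum_sub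
    (summable_logTerm (hη.trans_lt hr))]
  refine tsum_of_norm_bounded ((hasSum_geometric_of_lt_one hr0 hr).mul_right _) fun k => ?_
  rw [← smul_sub, norm_smul, norm_div, norm_pow, norm_neg, norm_one, one_pow,
    Real.norm_of_nonneg (by positivity)]
  calc _ ≤ 1 / ((k : ℝ) + 1) * ((k + 1) * r ^ k * ‖ξ - η‖) := by
        gcongr
        exact norm_pow_sub_pow_le hξ hη k
    _ = _ := by field_simp

lemma matLog_mul_comm {E : Mat n} (h : ‖E - 1‖ < 1) : matLog E * E = E * matLog E := by
  have hs := summable_logTerm h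
  rw [matLog, ← hs.tsum_mul_right, ← hs.tsum_mul_left]
  congr 1
  ext1 k
  rw [smul_mul_assoc, mul_smul_comm]
  congr 1
  exact (((Commute.refl E).sub_left (Commute.one_left E)).pow_left (k + 1)).eq

/-- Along `t ↦ exp (t A)` the series of the logarithm has derivative `A`, because its formal
derivative is a geometric series with sum `exp (-t A)`. -/
lemma eventually_matLog_exp : ∀ᶠ A : Mat n in 𝓝 0, matLog (NormedSpace.exp A) = A := by
  let _ : NormedAlgebra ℚ (Mat n) := NormedAlgebra.restrictScalars ℚ ℝ (Mat n)
  have hexp : Continuous (NormedSpace.exp : Mat n → Mat n) := NormedSpace.exp_continuous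
  have h1 : ∀ᶠ A : Mat n in 𝓝 0, ‖NormedSpace.exp A - 1‖ < 1 / 2 := by
    have : Tendsto (fun A : Mat n => ‖NormedSpace.exp A - 1‖) (𝓝 0) (𝓝 0) := by
      have h : Continuous fun A : Mat n => ‖NormedSpace.exp A - 1‖ := by fun_prop
      simpa using h.tendsto 0
    exact this.eventually (gt_mem_nhds (by norm_num))
  obtain ⟨δ, hδ, hball⟩ := Metric.eventually_nhds_iff_ball.1 h1
  refine Metric.eventually_nhds_iff_ball.2 ⟨δ / 2, by positivity, fun A hA => ?_⟩
  have hA' : ‖A‖ < δ / 2 := by simpa using hA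
  set y : ℝ → Mat n := fun t => NormedSpace.exp (t • A) with hy
  have hyd (t : ℝ) : HasDerivAt y (y t * A) t := hasDerivAt_exp_smul_const A t
  have hyA (t : ℝ) : Commute (y t) A :=
    ((Commute.refl A).smul_left t).exp_left
  have hyn {t : ℝ} (ht : t ∈ ball (0 : ℝ) 2) : ‖y t - 1‖ < 1 / 2 := by
    refine hball _ ?_
    have ht' : ‖t‖ < 2 := by simpa using ht
    rw [mem_ball_zero_iff, norm_smul]
    nlinarith [norm_nonneg A, norm_nonneg t]
  have hg (k : ℕ) (t : ℝ) : HasDerivAt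
      (fun t => ((-1 : ℝ) ^ k / ((k : ℝ) + 1)) • (y t - 1) ^ (k + 1))
      ((-(y t - 1)) ^ k * (y t * A)) t := by
    have hc : Commute (y t - 1) (y t * A) :=
      ((Commute.refl (y t)).mul_right (hyA t)).sub_left (Commute.one_left _)
    have hp : ∀ k : ℕ, HasDerivAt (fun t => (y t - 1) ^ (k + 1))
        (((k : ℝ) + 1) • ((y t - 1) ^ k * (y t * A))) t := by
      intro k
      induction k with
      | zero => simpa using (hyd t).sub_const 1
      | succ k ih =>
        have := ih.mul ((hyd t).sub_const (1 : Mat n))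
        refine (this.congr_of_eventuallyEq ?_).congr_deriv ?_
        · exact Eventually.of_forall fun s => pow_succ _ _
        · rw [smul_mul_assoc, mul_assoc, ← hc.eq, ← mul_assoc, ← pow_succ]
          push_cast
          module
    refine ((hp k).const_smul ((-1 : ℝ) ^ k / ((k : ℝ) + 1))).congr_deriv ?_
    rw [smul_smul, div_mul_cancel₀ _ (by positivity), neg_pow (y t - 1) k]
    rcases Nat.even_or_odd k with h | h <;> simp only [h.neg_one_pow, one_smul, neg_smul, one_mul,
      neg_mul]
  have hgn (k : ℕ) (t : ℝ) (ht : t ∈ ball (0 : ℝ) 2) :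
      ‖(-(y t - 1)) ^ k * (y t * A)‖ ≤ (1 / 2 : ℝ) ^ k * ((‖(1 : Mat n)‖ + 1 / 2) * ‖A‖) := by
    have e : ‖y t‖ ≤ ‖(1 : Mat n)‖ + 1 / 2 := by
      calc ‖y t‖ = ‖1 + (y t - 1)‖ := by simp
        _ ≤ _ := (norm_add_le _ _).trans (by gcongr; exact (hyn ht).le)
    refine (norm_mul_le _ _).trans ?_
    gcongr
    · refine (norm_pow_le_pow_norm _ k).trans ?_
      rw [norm_neg]
      gcongr
      exact (hyn ht).le
    · exact (norm_mul_le _ _).trans (by gcongr)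
  have hsum : Summable fun k : ℕ => (1 / 2 : ℝ) ^ k * ((‖(1 : Mat n)‖ + 1 / 2) * ‖A‖) :=
    summable_geometric_two.mul_right _
  have hd (t : ℝ) (ht : t ∈ ball (0 : ℝ) 2) : HasDerivAt (fun t => matLog (y t)) A t := by
    have hs0 : Summable fun k : ℕ =>
        ((-1 : ℝ) ^ k / ((k : ℝ) + 1)) • (y 0 - 1) ^ (k + 1) :=
      summable_logTerm ((hyn (by simp)).trans (by norm_num))
    refine (hasDerivAt_tsum_of_isPreconnected hsum isOpen_ball
      (convex_ball (0 : ℝ) 2).isPreconnected (fun k s _ => hg k s) hgn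
      (y₀ := 0) (by simp) hs0 ht).congr_deriv ?_
    have hlt : ‖-(y t - 1)‖ < 1 := by rw [norm_neg]; exact (hyn ht).trans (by norm_num)
    have hgeo := geom_series_mul_neg (-(y t - 1)) hlt
    have hsm : Summable fun k : ℕ => (-(y t - 1)) ^ k := summable_geometric_of_norm_lt_one hlt
    rw [hsm.tsum_mul_right, ← mul_assoc]
    simp only [sub_neg_eq_add, add_sub_cancel] at hgeo
    rw [hgeo, one_mul]
  have hmem {t : ℝ} (ht : t ∈ Icc (0 : ℝ) 1) : t ∈ ball (0 : ℝ) 2 := by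
    rw [mem_ball_zero_iff, Real.norm_of_nonneg ht.1]
    linarith [ht.2]
  have key := constant_of_has_deriv_right_zero (a := (0 : ℝ)) (b := 1)
    (f := fun t => matLog (y t) - t • A)
    (fun t ht => ((hd t (hmem ht)).continuousAt.sub
      (by fun_prop : Continuous fun t : ℝ => t • A).continuousAt).continuousWithinAt)
    (fun t ht => by
      have h2 : HasDerivAt (fun t : ℝ => t • A) A t := by
        simpa using (hasDerivAt_id t).smul_const A
      exact (((hd t (hmem (Ico_subset_Icc_self ht))).sub h2).congr_deriv
        (sub_self A)).hasDerivWithinAt)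
    1 (by simp)
  have h0 : matLog (1 : Mat n) = 0 := by simp [matLog]
  simpa [h0, hy, sub_eq_zero] using key

end Logarithm

/-! ### Closed linear groups and their Lie algebras -/

section LieGroup

variable {n : ℕ} {G : Subgroup (Matrix.GeneralLinearGroup (Fin n) ℝ)}

lemma one_mem_groupSet : (1 : Mat n) ∈ groupSet G := ⟨1, G.one_mem, rfl⟩

lemma mul_mem_groupSet {A B : Mat n} (hA : A ∈ groupSet G) (hB : B ∈ groupSet G) :
    A * B ∈ groupSet G := by
  obtain ⟨g, hg, rfl⟩ := hA
  obtain ⟨h, hh, rfl⟩ := hB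
  exact ⟨g * h, G.mul_mem hg hh, rfl⟩

lemma inv_mem_groupSet {A : Mat n} (hA : A ∈ groupSet G) : A⁻¹ ∈ groupSet G := by
  obtain ⟨g, hg, rfl⟩ := hA
  exact ⟨g⁻¹, G.inv_mem hg, by simp⟩

lemma isUnit_of_mem_groupSet {A : Mat n} (hA : A ∈ groupSet G) : IsUnit A := by
  obtain ⟨g, -, rfl⟩ := hA
  exact g.isUnit

lemma inv_mul_cancel_of_mem_groupSet {A : Mat n} (hA : A ∈ groupSet G) : A⁻¹ * A = 1 :=
  Matrix.nonsing_inv_mul A ((Matrix.isUnit_iff_isUnit_det A).1 (isUnit_of_mem_groupSet hA))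

lemma mul_inv_cancel_of_mem_groupSet {A : Mat n} (hA : A ∈ groupSet G) : A * A⁻¹ = 1 :=
  Matrix.mul_nonsing_inv A ((Matrix.isUnit_iff_isUnit_det A).1 (isUnit_of_mem_groupSet hA))

/-- A group that is closed in `GL(n, ℝ)` need not be closed in the space of all matrices, but the
only limit points it lacks are singular. -/
lemma mem_groupSet_of_mem_closure
    (hG : IsClosed (G : Set (Matrix.GeneralLinearGroup (Fin n) ℝ))) {A : Mat n}
    (hA : A ∈ closure (groupSet G)) (hu : IsUnit A) : A ∈ groupSet G := by
  obtain ⟨v, rfl⟩ := hu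
  have he : groupSet G = Units.val '' (G : Set (Matrix.GeneralLinearGroup (Fin n) ℝ)) := by
    ext B; simp [groupSet]
  have h1 : v ∈ closure (G : Set (Matrix.GeneralLinearGroup (Fin n) ℝ)) := by
    rw [(Units.isOpenEmbedding_val (R := Mat n)).isEmbedding.closure_eq_preimage_closure_image,
      mem_preimage, ← he]
    exact hA
  rw [hG.closure_eq] at h1
  exact ⟨v, h1, rfl⟩

/-- `w` is the right derivative at the identity of a curve in `G`. -/
def IsTangent (G : Subgroup (Matrix.GeneralLinearGroup (Fin n) ℝ)) (w : Mat n) : Prop :=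
  ∃ c : ℝ → Mat n, (∀ h, 0 < h → c h ∈ groupSet G) ∧ c 0 = 1 ∧ HasDerivWithinAt c w (Ici 0) 0

lemma isTangent_of_mem_lieSet {A : Mat n} (hA : A ∈ lieSet G) : IsTangent G A :=
  ⟨fun h => NormedSpace.exp (h • A), fun h _ => hA h, by simp, by
    simpa using (hasDerivAt_exp_smul_const A (0 : ℝ)).hasDerivWithinAt⟩

lemma IsTangent.add {A B : Mat n} (hA : IsTangent G A) (hB : IsTangent G B) :
    IsTangent G (A + B) := by
  obtain ⟨c, hc, hc0, hcd⟩ := hA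
  obtain ⟨e, he, he0, hed⟩ := hB
  refine ⟨fun h => c h * e h, fun h hh => mul_mem_groupSet (hc h hh) (he h hh), by simp [hc0, he0],
    ?_⟩
  exact (hcd.mul hed).congr_deriv (by simp [hc0, he0])

/-- A curve with logarithmic derivative tangent to `G` cannot leave the closure of `G`: its
distance to `G` satisfies a Grönwall inequality, because moving by the tangent curve maps `G` to
itself and changes distances by a factor `1 + O(h)` only. -/
lemma mem_closure_of_hasDerivWithinAt {w E : ℝ → Mat n} {K : ℝ}
    (hw : ∀ t, 0 ≤ t → IsTangent G (w t))
    (hK : ∀ t, 0 ≤ t → ‖w t‖ ≤ K)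
    (hE : ∀ t, 0 ≤ t → HasDerivWithinAt E (w t * E t) (Ici 0) t) (h0 : E 0 ∈ groupSet G)
    {t : ℝ} (ht : 0 ≤ t) : E t ∈ closure (groupSet G) := by
  have hne : (groupSet G).Nonempty := ⟨_, h0⟩
  set f : ℝ → ℝ := fun t => infDist (E t) (groupSet G) with hf
  have hf0 (s : ℝ) : 0 ≤ f s := infDist_nonneg
  have key := le_gronwallBound_of_liminf_deriv_right_le (f := f) (f' := fun s => ‖w s‖ * f s)
    (δ := 0) (K := K) (ε := 0) (a := 0) (b := t) ?_ ?_ ?_ ?_ t ⟨ht, le_rfl⟩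
  · rw [gronwallBound_ε0_δ0] at key
    exact (mem_closure_iff_infDist_zero hne).2 (le_antisymm key (hf0 t))
  · exact (continuous_infDist_pt _).comp_continuousOn fun s hs =>
      ((hE s hs.1).continuousWithinAt).mono Icc_subset_Ici_self
  · intro x hx r hr
    obtain ⟨c, hc, hc0, hcd⟩ := hw x hx.1
    have hcd' : HasDerivWithinAt (fun z => c (z - x)) (w x) (Ici x) x := by
      have h1 : HasDerivWithinAt (fun z : ℝ => z - x) 1 (Ici x) x :=
        ((hasDerivAt_id x).sub_const x).hasDerivWithinAt
      have h2 : HasDerivWithinAt c (w x) (Ici 0) (x - x) := by simpa using hcd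
      exact (HasDerivWithinAt.scomp (g₁ := c) (h := fun z : ℝ => z - x) (t' := Ici 0) x h2 h1
        (fun z (hz : x ≤ z) => mem_Ici.2 (sub_nonneg.2 hz))).congr_deriv (one_smul _ _)
    -- The curve and the translate of `E x` by the tangent curve agree to first order.
    have hd : HasDerivWithinAt (fun z => E z - c (z - x) * E x) 0 (Ici x) x := by
      have := ((hE x hx.1).mono (Ici_subset_Ici.2 hx.1)).sub (hcd'.mul_const (E x))
      exact this.congr_deriv (sub_self _)
    have t1 := (hasDerivWithinAt_iff_tendsto_slope' self_notMem_Ioi).1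
      (hcd'.mono Ioi_subset_Ici_self)
    have t2 := (hasDerivWithinAt_iff_tendsto_slope' self_notMem_Ioi).1 (hd.mono Ioi_subset_Ici_self)
    have t3 : Tendsto (fun z => ‖slope (fun z => E z - c (z - x) * E x) x z‖
        + ‖slope (fun z => c (z - x)) x z‖ * f x) (𝓝[>] x) (𝓝 (‖w x‖ * f x)) := by
      simpa using t2.norm.add (t1.norm.mul_const (f x))
    refine ((t3.eventually (gt_mem_nhds hr)).and self_mem_nhdsWithin).frequently.mono ?_
    rintro z ⟨hz, hxz⟩
    have hpos : 0 < z - x := sub_pos.2 hxz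
    refine lt_of_le_of_lt ?_ hz
    have hstep : f z ≤ ‖E z - c (z - x) * E x‖ + ‖c (z - x)‖ * f x := by
      have hdist (g : Mat n) (hg : g ∈ groupSet G) :
          f z ≤ ‖E z - c (z - x) * E x‖ + ‖c (z - x)‖ * dist (E x) g := by
        refine (infDist_le_dist_of_mem (mul_mem_groupSet (hc _ hpos) hg)).trans ?_
        rw [dist_eq_norm, dist_eq_norm]
        calc ‖E z - c (z - x) * g‖ = ‖(E z - c (z - x) * E x) + c (z - x) * (E x - g)‖ := by
              congr 1; noncomm_ring
          _ ≤ _ := (norm_add_le _ _).trans (by gcongr; exact norm_mul_le _ _)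
      refine le_of_forall_pos_le_add fun ε hε => ?_
      obtain ⟨g, hg, hgd⟩ := (infDist_lt_iff hne).1
        (lt_add_of_pos_right (f x) (div_pos hε (by positivity : 0 < ‖c (z - x)‖ + 1)))
      calc f z ≤ _ := hdist g hg
        _ ≤ ‖E z - c (z - x) * E x‖ + ‖c (z - x)‖ * (f x + ε / (‖c (z - x)‖ + 1)) := by gcongr
        _ ≤ _ := by
          have : ‖c (z - x)‖ * (ε / (‖c (z - x)‖ + 1)) ≤ ε := by
            rw [mul_div_assoc', div_le_iff₀ (by positivity)]
            nlinarith [norm_nonneg (c (z - x))]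
          linarith
    have hc1 : ‖c (z - x)‖ ≤ 1 + ‖c (z - x) - 1‖ := by
      calc ‖c (z - x)‖ = ‖1 + (c (z - x) - 1)‖ := by simp
        _ ≤ ‖(1 : Mat n)‖ + _ := norm_add_le _ _
        _ ≤ _ := by gcongr; exact norm_one_le
    simp only [slope_def_module, sub_self, hc0, one_mul, sub_zero, norm_smul, norm_inv,
      Real.norm_of_nonneg hpos.le]
    rw [mul_assoc, ← mul_add]
    gcongr
    nlinarith [hf0 x]
  · exact (infDist_zero_of_mem h0).le
  · intro x hx
    rw [add_zero]
    exact mul_le_mul_of_nonneg_right (hK x hx.1) (hf0 x)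

lemma mem_lieSet_of_nonneg {A : Mat n}
    (h : ∀ t : ℝ, 0 ≤ t → NormedSpace.exp (t • A) ∈ groupSet G) : A ∈ lieSet G := by
  intro t
  rcases le_total 0 t with ht | ht
  · exact h t ht
  · have := inv_mem_groupSet (h (-t) (by linarith))
    rwa [← Matrix.exp_neg, neg_smul, neg_neg] at this

lemma mem_lieSet_of_isTangent (hG : IsClosed (G : Set (Matrix.GeneralLinearGroup (Fin n) ℝ)))
    {A : Mat n} (hA : IsTangent G A) : A ∈ lieSet G :=
  mem_lieSet_of_nonneg fun t ht => mem_groupSet_of_mem_closure hG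
    (mem_closure_of_hasDerivWithinAt (w := fun _ => A) (K := ‖A‖) (fun _ _ => hA)
      (fun _ _ => le_rfl)
      (fun s _ => (hasDerivAt_exp_smul_const' A s).hasDerivWithinAt)
      (by simpa using one_mem_groupSet) ht)
    (Matrix.isUnit_exp _)

/-- The Lie algebra of a closed linear group, as a space of matrices. -/
def lieSubmodule (G : Subgroup (Matrix.GeneralLinearGroup (Fin n) ℝ))
    (hG : IsClosed (G : Set (Matrix.GeneralLinearGroup (Fin n) ℝ))) : Submodule ℝ (Mat n) where
  carrier := lieSet G
  add_mem' hA hB := mem_lieSet_of_isTangent hG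
    ((isTangent_of_mem_lieSet hA).add (isTangent_of_mem_lieSet hB))
  zero_mem' t := by simpa using one_mem_groupSet
  smul_mem' s A hA t := by simpa [smul_smul] using hA (t * s)

lemma exists_continuousLinearMap_projection (S : Submodule ℝ (Mat n)) :
    ∃ P : Mat n →L[ℝ] Mat n, (∀ A, P A ∈ S) ∧ ∀ A ∈ S, P A = A := by
  obtain ⟨f, hf⟩ := LinearMap.exists_leftInverse_of_injective S.subtype (Submodule.ker_subtype S)
  refine ⟨(S.subtype ∘ₗ f).toContinuousLinearMap, fun A => (f A).2, fun A hA => ?_⟩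
  have := LinearMap.congr_fun hf ⟨A, hA⟩
  simpa using congrArg Subtype.val this

/-- Directions transverse to the Lie algebra leave the group at once: a limit of the normalized
logarithms of a sequence in `G` tending to the identity lies in the Lie algebra. -/
lemma eventually_exp_mem_imp_eq_zero
    (hG : IsClosed (G : Set (Matrix.GeneralLinearGroup (Fin n) ℝ)))
    {P : Mat n →L[ℝ] Mat n} (hP : ∀ A ∈ lieSet G, P A = A) :
    ∀ᶠ b : Mat n in 𝓝 0, P b = 0 → NormedSpace.exp b ∈ groupSet G → b = 0 := by
  let _ : NormedAlgebra ℚ (Mat n) := NormedAlgebra.restrictScalars ℚ ℝ (Mat n)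
  by_contra hcon
  rw [not_eventually] at hcon
  obtain ⟨b, hb, hbp⟩ := exists_seq_forall_of_frequently hcon
  simp only [Classical.not_imp] at hbp
  have hpos (k : ℕ) : 0 < ‖b k‖ := norm_pos_iff.2 (hbp k).2.2
  set v : ℕ → Mat n := fun k => ‖b k‖⁻¹ • b k with hv
  have hvm (k : ℕ) : v k ∈ sphere (0 : Mat n) 1 := by
    simp [hv, norm_smul, (hpos k).ne']
  obtain ⟨a, ha, φ, hφ, hlim⟩ := (isCompact_sphere (0 : Mat n) 1).tendsto_subseq hvm
  have ha1 : ‖a‖ = 1 := by simpa using ha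
  have hPa : P a = 0 := by
    refine tendsto_nhds_unique ((P.continuous.tendsto a).comp hlim) ?_
    have : ∀ k, (P ∘ v ∘ φ) k = 0 := fun k => by simp [hv, (hbp (φ k)).1]
    exact tendsto_const_nhds.congr fun k => (this k).symm
  have haL : a ∈ lieSet G := by
    intro t
    -- The powers `exp (b k) ^ ⌊t / ‖b k‖⌋` lie in `G` and converge to `exp (t a)`.
    refine mem_groupSet_of_mem_closure hG ?_ (Matrix.isUnit_exp _)
    have hnb : Tendsto (fun k => ‖b (φ k)‖) atTop (𝓝 0) := by
      simpa using (hb.comp hφ.tendsto_atTop).norm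
    have hfl : Tendsto (fun k => (⌊t / ‖b (φ k)‖⌋ : ℝ) * ‖b (φ k)‖) atTop (𝓝 t) := by
      refine tendsto_of_tendsto_of_tendsto_of_le_of_le (g := fun k => t - ‖b (φ k)‖)
        (h := fun _ => t) (by simpa using hnb.const_sub t) tendsto_const_nhds ?_ ?_
      · intro k
        have h1 := Int.lt_floor_add_one (t / ‖b (φ k)‖)
        rw [div_lt_iff₀ (hpos _)] at h1
        simp only
        nlinarith
      · intro k
        have h1 := Int.floor_le (t / ‖b (φ k)‖)
        rwa [le_div_iff₀ (hpos _)] at h1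
    have hl : Tendsto (fun k => NormedSpace.exp
        (((⌊t / ‖b (φ k)‖⌋ : ℝ) * ‖b (φ k)‖) • v (φ k))) atTop (𝓝 (NormedSpace.exp (t • a))) :=
      (NormedSpace.exp_continuous.tendsto _).comp (hfl.smul hlim)
    refine mem_closure_of_tendsto hl (Eventually.of_forall fun k => ?_)
    have he : ((⌊t / ‖b (φ k)‖⌋ : ℝ) * ‖b (φ k)‖) • v (φ k) = ⌊t / ‖b (φ k)‖⌋ • b (φ k) := by
      simp only [hv]
      rw [smul_smul, mul_assoc, mul_inv_cancel₀ (hpos _).ne', mul_one, Int.cast_smul_eq_zsmul]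
    rw [he, Matrix.exp_zsmul]
    obtain ⟨g, hg, hge⟩ := (hbp (φ k)).2.1
    exact ⟨g ^ ⌊t / ‖b (φ k)‖⌋, G.zpow_mem hg _, by rw [← hge, Matrix.coe_units_zpow]⟩
  have : a = 0 := by rw [← hP a haL, hPa]
  simp [this] at ha1

/-- Near the identity the logarithm maps a closed linear group into its Lie algebra. If `P` is a
projection onto the Lie algebra, then `x ↦ exp (P x) exp (x - P x)` is open at `0`, and an element
of `G` of this form has `x = P x`. -/
lemma eventually_matLog_mem_lieSet
    (hG : IsClosed (G : Set (Matrix.GeneralLinearGroup (Fin n) ℝ))) :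
    ∀ᶠ E : Mat n in 𝓝 1, E ∈ groupSet G → matLog E ∈ lieSet G := by
  obtain ⟨P, hPm, hP⟩ := exists_continuousLinearMap_projection (lieSubmodule G hG)
  set Q : Mat n →L[ℝ] Mat n := ContinuousLinearMap.id ℝ (Mat n) - P with hQ
  have hexp (L : Mat n →L[ℝ] Mat n) :
      HasStrictFDerivAt (fun x => NormedSpace.exp (L x)) L 0 := by
    have h1 : HasStrictFDerivAt (NormedSpace.exp : Mat n → Mat n)
        (1 : Mat n →L[ℝ] Mat n) (L 0) := by
      rw [map_zero]; exact hasStrictFDerivAt_exp_zero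
    exact (h1.comp 0 L.hasStrictFDerivAt).congr_fderiv (by ext; simp)
  have hψ : HasStrictFDerivAt (fun x => NormedSpace.exp (P x) * NormedSpace.exp (Q x))
      ((ContinuousLinearEquiv.refl ℝ (Mat n) : Mat n ≃L[ℝ] Mat n) : Mat n →L[ℝ] Mat n) 0 := by
    refine ((hexp P).mul' (hexp Q)).congr_fderiv ?_
    ext1 x
    simp [hQ]
  have hmap := hψ.map_nhds_eq_of_equiv
  simp only [map_zero, NormedSpace.exp_zero, mul_one] at hmap
  have tQ : Tendsto Q (𝓝 0) (𝓝 0) := by simpa using Q.continuous.tendsto 0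
  have tP : Tendsto P (𝓝 0) (𝓝 0) := by simpa using P.continuous.tendsto 0
  have hev := (tQ.eventually (eventually_exp_mem_imp_eq_zero hG hP)).and
    (tP.eventually eventually_matLog_exp)
  rw [← hmap, eventually_map]
  filter_upwards [hev] with x ⟨hx1, hx2⟩ hg
  have hPQ : P (Q x) = 0 := by
    simp [hQ, hP (P x) (hPm x)]
  have hPx : NormedSpace.exp (P x) ∈ groupSet G := by
    simpa using (hPm x : P x ∈ lieSet G) 1
  have hQx : NormedSpace.exp (Q x) ∈ groupSet G := by
    have := mul_mem_groupSet (inv_mem_groupSet hPx) hg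
    rwa [← mul_assoc, inv_mul_cancel_of_mem_groupSet hPx, one_mul] at this
  rw [hx1 hPQ hQx, NormedSpace.exp_zero, mul_one, hx2]
  exact hPm x

end LieGroup

/-! ### Norms that decrease along a Hurwitz linear system -/

section HurwitzNorm

open scoped NNReal

lemma exists_norm_one_add_mul_le {l : ℂ} (hl : l.re < 0) :
    ∃ h₀ > 0, ∀ h ∈ Icc (0 : ℝ) h₀, ‖1 + (h : ℂ) * l‖ ≤ 1 - -l.re / 2 * h := by
  have hn : 0 < Complex.normSq l := Complex.normSq_pos.2 (by rintro rfl; simp at hl)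
  have hre : l.re ^ 2 ≤ Complex.normSq l := by
    rw [Complex.normSq_apply]; nlinarith [mul_self_nonneg l.im]
  refine ⟨-l.re / Complex.normSq l, div_pos (by linarith) hn, fun h hh => ?_⟩
  have h2 := hh.2
  rw [le_div_iff₀ hn] at h2
  have h3 : -l.re * h ≤ 1 := by nlinarith [hh.1]
  refine abs_le_of_sq_le_sq' ?_ (by linarith) |>.2
  rw [← Complex.normSq_eq_norm_sq, Complex.normSq_apply]
  rw [Complex.normSq_apply] at h2
  simp only [Complex.add_re, Complex.one_re, Complex.mul_re, Complex.ofReal_re, Complex.ofReal_im,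
    zero_mul, sub_zero, Complex.add_im, Complex.one_im, Complex.mul_im, add_zero, zero_add]
  nlinarith [mul_le_mul_of_nonneg_left h2 hh.1, sq_nonneg (l.re * h), hh.1]

/-- On the kernel of `∏ (A - l)`, where `l` runs through numbers with negative real part, there is
a norm that decreases to first order along `x' = A x`. Adding the factor `l` turns a norm `N` into
`‖x‖ + κ N ((A - l) x)`: the coupling term `(A - l) x` in `A x = l x + (A - l) x` is absorbed by
the decay of `N` as soon as `κ` is large. -/
lemma exists_contracting_seminorm {W : Type*} [NormedAddCommGroup W] [NormedSpace ℂ W]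
    (A : W →L[ℂ] W) (s : Multiset ℂ) (hs : ∀ l ∈ s, l.re < 0) :
    ∃ (N : Seminorm ℂ W) (C β h₀ : ℝ), 0 ≤ C ∧ 0 < β ∧ 0 < h₀ ∧ (∀ x, N x ≤ C * ‖x‖) ∧
      ∀ x, Polynomial.aeval A (s.map fun l => Polynomial.X - Polynomial.C l).prod x = 0 →
        ‖x‖ ≤ N x ∧ ∀ h ∈ Icc (0 : ℝ) h₀, N (x + (h : ℂ) • A x) ≤ (1 - β * h) * N x := by
  induction s using Multiset.induction with
  | empty =>
    refine ⟨0, 0, 1, 1, le_rfl, one_pos, one_pos, by simp, fun x hx => ?_⟩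
    have : x = 0 := by simpa using hx
    simp [this]
  | cons l s ih =>
    obtain ⟨N, C, β, h₀, hC, hβ, hh₀, hN, hk⟩ := ih fun l hl => hs l (Multiset.mem_cons_of_mem hl)
    have hl : l.re < 0 := hs l (Multiset.mem_cons_self l s)
    obtain ⟨h₁, hh₁, hl1⟩ := exists_norm_one_add_mul_le hl
    set B : W →L[ℂ] W := A - l • ContinuousLinearMap.id ℂ W with hB
    have hBx (x : W) : B x = A x - l • x := by simp [hB]
    -- With `κ = 2 / β` the coupling term `h * N (B x)` takes one half of the decay rate `β` of `N`.
    set κ : ℝ≥0 := ⟨2 / β, by positivity⟩ with hκ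
    set N' : Seminorm ℂ W := normSeminorm ℂ W + κ • N.comp (B : W →ₗ[ℂ] W) with hN'
    have hN'x (x : W) : N' x = ‖x‖ + 2 / β * N (B x) := by
      change ‖x‖ + (κ : ℝ) * N (B x) = _
      rfl
    refine ⟨N', 1 + 2 / β * (C * ‖B‖), min (-l.re / 2) (β / 2), min h₀ h₁, by positivity,
      lt_min (by linarith) (by linarith), lt_min hh₀ hh₁, fun x => ?_, fun x hx => ?_⟩
    · rw [hN'x, add_mul, one_mul, mul_assoc, mul_assoc]
      gcongr
      exact (hN _).trans (by gcongr; exact B.le_opNorm x)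
    · have hy : Polynomial.aeval A
          (s.map fun l => Polynomial.X - Polynomial.C l).prod (B x) = 0 := by
        rw [Multiset.map_cons, Multiset.prod_cons, mul_comm, map_mul] at hx
        have e : Polynomial.aeval A (Polynomial.X - Polynomial.C l) = B := by
          ext1 y
          simp [hBx, Algebra.algebraMap_eq_smul_one]
        rw [e] at hx
        exact hx
      obtain ⟨hy1, hy2⟩ := hk _ hy
      refine ⟨?_, fun h hh => ?_⟩
      · rw [hN'x]
        exact le_add_of_nonneg_right (mul_nonneg (by positivity) (apply_nonneg N _))
      have hcomm : B (x + (h : ℂ) • A x) = B x + (h : ℂ) • A (B x) := by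
        simp only [hBx, map_add, map_smul, map_sub]; module
      have e1 : x + (h : ℂ) • A x = (1 + (h : ℂ) * l) • x + (h : ℂ) • B x := by
        rw [hBx]; module
      have n1 : ‖x + (h : ℂ) • A x‖ ≤ (1 - -l.re / 2 * h) * ‖x‖ + h * N (B x) := by
        rw [e1]
        refine (norm_add_le _ _).trans ?_
        rw [norm_smul, norm_smul, Complex.norm_real, Real.norm_of_nonneg hh.1]
        have := hl1 h ⟨hh.1, hh.2.trans (min_le_right _ _)⟩
        have := hh.1
        gcongr
      have n2 := hy2 h ⟨hh.1, hh.2.trans (min_le_left _ _)⟩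
      rw [hN'x, hN'x, hcomm]
      have m1 := min_le_left (-l.re / 2) (β / 2)
      have m2 := min_le_right (-l.re / 2) (β / 2)
      set γ := min (-l.re / 2) (β / 2)
      have hN0 := apply_nonneg N (B x)
      calc _ ≤ (1 - -l.re / 2 * h) * ‖x‖ + h * N (B x) + 2 / β * ((1 - β * h) * N (B x)) := by
            gcongr
        _ = (1 - -l.re / 2 * h) * ‖x‖ + 2 / β * ((1 - β / 2 * h) * N (B x)) := by
            field_simp; ring
        _ ≤ (1 - γ * h) * ‖x‖ + 2 / β * ((1 - γ * h) * N (B x)) := by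
            have := hh.1
            gcongr
        _ = _ := by ring

end HurwitzNorm

/-! ### The linearized error system -/

section ErrorOperator

variable {𝕜 M : Type*} [NontriviallyNormedField 𝕜] [NormedAddCommGroup M] [NormedSpace 𝕜 M]

/-- The `k`-th coordinate of `z : Fin d → M`, with value `0` for `k ≥ d`. -/
def coord (𝕜 : Type*) {M : Type*} [NontriviallyNormedField 𝕜] [NormedAddCommGroup M]
    [NormedSpace 𝕜 M] (d k : ℕ) : (Fin d → M) →L[𝕜] M :=
  if h : k < d then ContinuousLinearMap.proj ⟨k, h⟩ else 0

lemma coord_of_lt {d k : ℕ} (h : k < d) (z : Fin d → M) : coord 𝕜 d k z = z ⟨k, h⟩ := by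
  simp [coord, h]

lemma coord_self (d : ℕ) (z : Fin d → M) : coord 𝕜 d d z = 0 := by simp [coord]

lemma norm_coord_le (d k : ℕ) (z : Fin d → M) : ‖coord 𝕜 d k z‖ ≤ ‖z‖ := by
  by_cases h : k < d
  · rw [coord_of_lt h]; exact norm_le_pi_norm z _
  · simp [coord, h]

/-- The operator of the linearized error system
`z₀' = z₁ - a_{d-1} z₀, …, z_{d-2}' = z_{d-1} - a₁ z₀, z_{d-1}' = - a₀ z₀`. -/
def errorOperator (𝕜 : Type*) {M : Type*} [NontriviallyNormedField 𝕜] [NormedAddCommGroup M]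
    [NormedSpace 𝕜 M] (d : ℕ) (a : ℕ → 𝕜) : (Fin d → M) →L[𝕜] (Fin d → M) :=
  ContinuousLinearMap.pi fun j => coord 𝕜 d (j + 1) - a (d - 1 - j) • coord 𝕜 d 0

lemma errorOperator_apply (d : ℕ) (a : ℕ → 𝕜) (z : Fin d → M) (j : Fin d) :
    errorOperator 𝕜 d a z j = coord 𝕜 d (j + 1) z - a (d - 1 - j) • coord 𝕜 d 0 z := rfl

open Polynomial in
/-- The intermediate results of Horner's scheme for `s^d + a_{d-1} s^{d-1} + ⋯ + a_0`. -/
noncomputable def hornerPolynomial (d : ℕ) (a : ℕ → 𝕜) : ℕ → 𝕜[X]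
  | 0 => 1
  | k + 1 => hornerPolynomial d a k * X + C (a (d - 1 - k))

open Polynomial in
lemma hornerPolynomial_eq (d : ℕ) (a : ℕ → 𝕜) {k : ℕ} (hk : k ≤ d) :
    hornerPolynomial d a k = X ^ k + ∑ i ∈ Finset.range k, C (a (d - k + i)) * X ^ i := by
  induction k with
  | zero => simp [hornerPolynomial]
  | succ k ih =>
    rw [hornerPolynomial, ih (by omega), Finset.sum_range_succ', add_mul, Finset.sum_mul]
    have h1 : d - 1 - k = d - (k + 1) := by omega
    have h2 : ∀ i, d - k + i = d - (k + 1) + (i + 1) := by omega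
    simp only [h1, h2, pow_succ, mul_assoc, pow_zero, mul_one, add_zero, add_assoc]

/-- `p(A) = 0` for the operator `A` of the linearized error system and
`p = s^d + a_{d-1} s^{d-1} + ⋯ + a_0`: the `k`-th coordinate is the zeroth one after
applying the `k`-th Horner polynomial of `A`, and the `d`-th coordinate vanishes. -/
lemma aeval_errorOperator (d : ℕ) (a : ℕ → 𝕜) :
    Polynomial.aeval (errorOperator 𝕜 d a : (Fin d → M) →L[𝕜] (Fin d → M))
      (Polynomial.X ^ d + ∑ i ∈ Finset.range d, Polynomial.C (a i) * Polynomial.X ^ i) = 0 := by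
  set A : (Fin d → M) →L[𝕜] (Fin d → M) := errorOperator 𝕜 d a
  have hq (k : ℕ) (hk : k ≤ d) (z : Fin d → M) :
      coord 𝕜 d 0 (Polynomial.aeval A (hornerPolynomial d a k) z) = coord 𝕜 d k z := by
    induction k generalizing z with
    | zero => simp [hornerPolynomial]
    | succ k ih =>
      have h1 := ih (by omega) (A z)
      rw [coord_of_lt (k := k) (by omega), errorOperator_apply] at h1
      simp [hornerPolynomial, Algebra.algebraMap_eq_smul_one, h1]
  have hp : hornerPolynomial d a d =
      Polynomial.X ^ d + ∑ i ∈ Finset.range d, Polynomial.C (a i) * Polynomial.X ^ i := by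
    simpa using hornerPolynomial_eq d a le_rfl
  rw [← hp]
  ext z j
  have h1 := hq j j.2.le (Polynomial.aeval A (hornerPolynomial d a d) z)
  rw [← mul_apply_eq_comp, ← map_mul, mul_comm, map_mul,
    mul_apply_eq_comp, hq d le_rfl, coord_self, coord_of_lt j.2] at h1
  simpa using h1.symm

end ErrorOperator

section ErrorNorm

variable {n d : ℕ} {a : ℕ → ℝ}

lemma exists_multiset_gainPolynomial (ha : IsHurwitz (gainPolynomial d a)) :
    ∃ s : Multiset ℂ, (∀ l ∈ s, l.re < 0) ∧
      (s.map fun l => Polynomial.X - Polynomial.C l).prod =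
        Polynomial.X ^ d + ∑ i ∈ Finset.range d, Polynomial.C (a i : ℂ) * Polynomial.X ^ i := by
  have hmap : (gainPolynomial d a).map (algebraMap ℝ ℂ) =
      Polynomial.X ^ d + ∑ i ∈ Finset.range d, Polynomial.C (a i : ℂ) * Polynomial.X ^ i := by
    simp [gainPolynomial, Polynomial.map_sum]
  have hm : (gainPolynomial d a).Monic := by
    refine Polynomial.monic_X_pow_add ?_
    refine (Polynomial.degree_sum_le _ _).trans_lt ?_
    refine (Finset.sup_lt_iff (WithBot.bot_lt_coe d)).2 fun i hi => ?_
    exact (Polynomial.degree_C_mul_X_pow_le i (a i)).trans_lt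
      (WithBot.coe_lt_coe.2 (Finset.mem_range.1 hi))
  set p := (gainPolynomial d a).map (algebraMap ℝ ℂ) with hp
  refine ⟨p.roots, fun l hl => ha l ?_, ?_⟩
  · rw [← Polynomial.eval_map_algebraMap]
    exact Polynomial.isRoot_of_mem_roots hl
  · rw [← hmap]
    exact ((IsAlgClosed.splits p).eq_prod_roots_of_monic (hm.map _)).symm

/-- A norm on the error space, equivalent to the given one, that decreases to first order along
the linearized error system. -/
lemma exists_contracting_errorNorm (n : ℕ) (ha : IsHurwitz (gainPolynomial d a)) :
    ∃ (N : Seminorm ℝ (Fin d → Mat n)) (C β h₀ : ℝ), 0 < C ∧ 0 < β ∧ 0 < h₀ ∧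
      (∀ x, N x ≤ C * ‖x‖) ∧ (∀ x, ‖x‖ ≤ C * N x) ∧
      ∀ x, ∀ h ∈ Icc (0 : ℝ) h₀, N (x + h • errorOperator ℝ d a x) ≤ (1 - β * h) * N x := by
  obtain ⟨s, hs, hprod⟩ := exists_multiset_gainPolynomial ha
  set A : (Fin d → Matrix (Fin n) (Fin n) ℂ) →L[ℂ] (Fin d → Matrix (Fin n) (Fin n) ℂ) :=
    errorOperator ℂ d fun i => (a i : ℂ)
  obtain ⟨N, C, β, h₀, hC, hβ, hh₀, hN, hk⟩ := exists_contracting_seminorm A s hs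
  rw [hprod, aeval_errorOperator] at hk
  -- The norm of the complexified system is pulled back along the inclusion of real matrices.
  let J : (Fin d → Mat n) →ₗ[ℝ] (Fin d → Matrix (Fin n) (Fin n) ℂ) :=
    { toFun := fun z j => (z j).map Complex.ofReal
      map_add' := fun z w => by ext; simp
      map_smul' := fun c z => by ext; simp }
  have hJ : Function.Injective J := by
    intro z w h
    ext j p q
    have := congrFun (congrFun (congrFun h j) p) q
    simpa [J] using this
  have hJA (z : Fin d → Mat n) : J (errorOperator ℝ d a z) = A (J z) := by
    have hc (k : ℕ) : coord ℂ d k (J z) = (coord ℝ d k z).map Complex.ofReal := by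
      by_cases h : k < d
      · rw [coord_of_lt h, coord_of_lt h]; rfl
      · ext; simp [coord, h]
    funext j
    change (errorOperator ℝ d a z j).map Complex.ofReal = A (J z) j
    rw [errorOperator_apply, errorOperator_apply, hc, hc]
    ext; simp
  obtain ⟨K, hK, hJK⟩ := LinearMap.exists_antilipschitzWith J (LinearMap.ker_eq_bot.2 hJ)
  let Jc := J.toContinuousLinearMap
  refine ⟨(N.restrictScalars ℝ).comp J, C * ‖Jc‖ + K + 1, β, h₀, by positivity, hβ, hh₀,
    fun x => ?_, fun x => ?_, fun x h hh => ?_⟩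
  · calc N (J x) ≤ C * (‖Jc‖ * ‖x‖) := (hN _).trans (by gcongr; exact Jc.le_opNorm x)
      _ ≤ _ := by
        rw [← mul_assoc]
        gcongr
        linarith [K.coe_nonneg]
  · have h1 : ‖x‖ ≤ K * ‖J x‖ := by simpa using hJK.le_mul_dist x 0
    have h2 := (hk (J x) rfl).1
    calc ‖x‖ ≤ K * N (J x) := h1.trans (by gcongr)
      _ ≤ _ := by
        change _ ≤ _ * N (J x)
        gcongr
        have : 0 ≤ C * ‖Jc‖ := by positivity
        linarith
  · change N (J (x + h • errorOperator ℝ d a x)) ≤ _ * N (J x)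
    have := (hk (J x) rfl).2 h hh
    rwa [map_add, map_smul, hJA, ← Complex.coe_smul]

end ErrorNorm

/-! ### Stability by linearization and global existence -/

section ODE

variable {V : Type*} [NormedAddCommGroup V] [NormedSpace ℝ V]

/-- Stability by linearization. The barrier `ρ exp (-β t / 2)` is not crossed, because the remainder
`r` is small compared with the linear decay wherever the barrier is touched; no bound on `r` away
from the origin is needed. -/
lemma seminorm_le_exp_mul {N : Seminorm ℝ V} {A : V → V} {C β h₀ ρ₀ : ℝ} (hβ : 0 < β)
    (hh₀ : 0 < h₀) (hN : ∀ x, N x ≤ C * ‖x‖)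
    (hA : ∀ x, ∀ h ∈ Icc (0 : ℝ) h₀, N (x + h • A x) ≤ (1 - β * h) * N x)
    {z r : ℝ → V} (hz : ∀ t, 0 ≤ t → HasDerivWithinAt z (A (z t) + r t) (Ici 0) t)
    (hr : ∀ t, 0 ≤ t → N (z t) < ρ₀ → N (r t) ≤ β / 4 * N (z t)) (h0 : N (z 0) < ρ₀)
    {t : ℝ} (ht : 0 ≤ t) : N (z t) ≤ Real.exp (-(β / 2) * t) * N (z 0) := by
  have hNc : Continuous N := by
    refine Seminorm.continuous_of_continuousAt_zero ?_
    have h1 : Tendsto (fun x : V => C * ‖x‖) (𝓝 0) (𝓝 0) := by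
      simpa using (tendsto_norm_zero (E := V)).const_mul C
    have h2 : Tendsto N (𝓝 0) (𝓝 0) :=
      squeeze_zero (fun x => apply_nonneg N x) hN h1
    simpa [ContinuousAt] using h2
  have barrier (ρ : ℝ) (hρ : ρ ∈ Ioo (N (z 0)) ρ₀) :
      N (z t) ≤ Real.exp (-(β / 2) * t) * ρ := by
    have hρ0 : 0 < ρ := (apply_nonneg N _).trans_lt hρ.1
    have hB (x : ℝ) : HasDerivAt (fun t => Real.exp (-(β / 2) * t) * ρ)
        (-(β / 2) * (Real.exp (-(β / 2) * x) * ρ)) x := by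
      have h1 : HasDerivAt (fun t : ℝ => -(β / 2) * t) (-(β / 2)) x := by
        simpa using (hasDerivAt_id x).const_mul (-(β / 2))
      exact (h1.exp.mul_const ρ).congr_deriv (by ring)
    refine image_le_of_liminf_slope_right_lt_deriv_boundary (f := fun t => N (z t))
      (f' := fun s => -β * N (z s) + N (r s)) (a := 0) (b := t) ?_ ?_ ?_ hB ?_ ⟨ht, le_rfl⟩
    · exact hNc.comp_continuousOn fun s hs =>
        ((hz s hs.1).continuousWithinAt).mono Icc_subset_Ici_self
    · intro x hx q hq
      have t1 := (hasDerivWithinAt_iff_tendsto_slope' self_notMem_Ioi).1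
        ((hz x hx.1).mono (fun y hy => hx.1.trans (le_of_lt hy) : Ioi x ⊆ Ici 0))
      have t2 : Tendsto (fun y => -β * N (z x) + N (r x)
          + N (slope z x y - (A (z x) + r x))) (𝓝[>] x) (𝓝 (-β * N (z x) + N (r x))) := by
        have h3 := (hNc.tendsto _).comp (t1.sub_const (A (z x) + r x))
        rw [sub_self, map_zero] at h3
        simpa using h3.const_add (-β * N (z x) + N (r x))
      have hev : ∀ᶠ y in 𝓝[>] x, y < x + h₀ :=
        nhdsWithin_le_nhds (gt_mem_nhds (by linarith))
      refine ((t2.eventually (gt_mem_nhds hq)).and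
        (hev.and self_mem_nhdsWithin)).frequently.mono ?_
      rintro y ⟨hy, hyh, hxy⟩
      have hpos : 0 < y - x := sub_pos.2 hxy
      refine lt_of_le_of_lt ?_ hy
      have e : z y = (z x + (y - x) • A (z x)) + ((y - x) • r x
          + (y - x) • (slope z x y - (A (z x) + r x))) := by
        have h4 : (y - x) • slope z x y = z y - z x := by
          rw [slope_def_module, smul_smul, mul_inv_cancel₀ hpos.ne', one_smul]
        rw [smul_sub, h4]
        module
      have h5 : N (z y) ≤ (1 - β * (y - x)) * N (z x) + ((y - x) * N (r x)
          + (y - x) * N (slope z x y - (A (z x) + r x))) := by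
        set w := slope z x y - (A (z x) + r x)
        have e1 : N (z x + (y - x) • A (z x)) ≤ (1 - β * (y - x)) * N (z x) :=
          hA _ _ ⟨hpos.le, by linarith⟩
        have e2 (v : V) : N ((y - x) • v) = (y - x) * N v := by
          rw [map_smul_eq_mul, Real.norm_of_nonneg hpos.le]
        have e3 := map_add_le_add N (z x + (y - x) • A (z x)) ((y - x) • r x + (y - x) • w)
        have e4 := map_add_le_add N ((y - x) • r x) ((y - x) • w)
        rw [e2, e2] at e4
        rw [e]
        linarith
      rw [slope_def_field, div_le_iff₀ hpos]
      linarith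
    · simpa using hρ.1.le
    · intro x hx hxB
      have hBpos : 0 < Real.exp (-(β / 2) * x) * ρ := by positivity
      have hle : Real.exp (-(β / 2) * x) * ρ ≤ ρ := by
        refine mul_le_of_le_one_left hρ0.le (Real.exp_le_one_iff.2 ?_)
        nlinarith [hx.1]
      have h6 := hr x hx.1 (by rw [hxB]; exact hle.trans_lt hρ.2)
      rw [hxB] at h6 ⊢
      nlinarith
  have hlim : Tendsto (fun ρ => Real.exp (-(β / 2) * t) * ρ) (𝓝[>] (N (z 0)))
      (𝓝 (Real.exp (-(β / 2) * t) * N (z 0))) :=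
    ((continuous_const.mul continuous_id).tendsto _).mono_left nhdsWithin_le_nhds
  exact ge_of_tendsto hlim (mem_of_superset (Ioo_mem_nhdsGT h0) barrier)

/-- A bounded Lipschitz vector field has solutions on `[0, ∞)`. -/
lemma exists_hasDerivWithinAt_Ici [CompleteSpace V] {F : V → V} {K L : NNReal}
    (hF : LipschitzWith K F) (hL : ∀ x, ‖F x‖ ≤ L) (x : V) :
    ∃ z : ℝ → V, z 0 = x ∧ ∀ t, 0 ≤ t → HasDerivWithinAt z (F (z t)) (Ici 0) t := by
  -- Since `F` is bounded, a ball of radius `L * k` contains every solution on `[0, k]`.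
  have hex (k : ℕ) : ∃ z : ℝ → V, z 0 = x ∧
      ∀ t ∈ Icc (0 : ℝ) k, HasDerivWithinAt z (F (z t)) (Icc 0 k) t := by
    have hPL : IsPicardLindelof (fun _ => F) (⟨0, le_rfl, k.cast_nonneg⟩ : Icc (0 : ℝ) k) x
        (L * k) 0 L K :=
      .of_time_independent (fun y _ => hL y) hF.lipschitzOnWith (by simp)
    exact hPL.exists_eq_forall_mem_Icc_hasDerivWithinAt₀
  choose Z hZ0 hZ using hex
  have hZr (k : ℕ) (t : ℝ) (ht : t ∈ Ico (0 : ℝ) k) :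
      HasDerivWithinAt (Z k) (F (Z k t)) (Ici 0) t :=
    (hZ k t (Ico_subset_Icc_self ht)).mono_of_mem_nhdsWithin (by
      filter_upwards [self_mem_nhdsWithin, nhdsWithin_le_nhds (gt_mem_nhds ht.2)] with s h1 h2
      exact ⟨h1, h2.le⟩)
  have hagree {k l : ℕ} (hkl : k ≤ l) {t : ℝ} (ht : t ∈ Icc (0 : ℝ) k) : Z k t = Z l t := by
    have hkl' : (k : ℝ) ≤ l := by exact_mod_cast hkl
    refine ODE_solution_unique (v := fun _ => F) (fun _ => hF)
      (fun s hs => (hZ k s hs).continuousWithinAt)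
      (fun s hs => (hZr k s hs).mono (Ici_subset_Ici.2 hs.1))
      (fun s hs => ((hZ l s (Icc_subset_Icc_right hkl' hs)).continuousWithinAt).mono
        (Icc_subset_Icc_right hkl'))
      (fun s hs => (hZr l s ⟨hs.1, hs.2.trans_le hkl'⟩).mono (Ici_subset_Ici.2 hs.1))
      (by rw [hZ0, hZ0]) ht
  refine ⟨fun t => Z (⌊t⌋₊ + 1) t, hZ0 _, fun t ht => ?_⟩
  have hlt (s : ℝ) : s < ((⌊s⌋₊ + 1 : ℕ) : ℝ) := by exact_mod_cast Nat.lt_floor_add_one s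
  refine (hZr (⌊t⌋₊ + 1) t ⟨ht, hlt t⟩).congr_of_eventuallyEq ?_ rfl
  filter_upwards [self_mem_nhdsWithin, nhdsWithin_le_nhds (gt_mem_nhds (hlt t))] with s h1 h2
  have h3 : ⌊s⌋₊ + 1 ≤ ⌊t⌋₊ + 1 := by
    have := (Nat.floor_lt h1).2 h2
    omega
  exact hagree h3 ⟨h1, (hlt s).le⟩

end ODE

/-! ### The error vector field -/

section ErrorField

variable {n d : ℕ} {a : ℕ → ℝ}

/-- The `k`-th driving term `P (z_{k+1} - a_{d-1-k} log (1 + z₀))` of the error system. -/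
noncomputable def errorDrive (d : ℕ) (a : ℕ → ℝ) (P : Mat n →L[ℝ] Mat n) (k : ℕ)
    (z : Fin d → Mat n) : Mat n :=
  P (coord ℝ d (k + 1) z - a (d - 1 - k) • matLog (1 + coord ℝ d 0 z))

/-- The vector field of the error system in the coordinates `z₀ = X⁻¹ Xh - 1` and
`z_j = xh_{j+1} - x_{j+1}`: the zeroth coordinate moves by left multiplication with its driving
term, the others by translation. The error system itself is the case of the identity `P`; a
projection `P` onto the Lie algebra makes the driving terms elements of the Lie algebra. -/
noncomputable def errorField (d : ℕ) (a : ℕ → ℝ) (P : Mat n →L[ℝ] Mat n) (z : Fin d → Mat n) :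
    Fin d → Mat n :=
  fun j => errorDrive d a P j z * (if (j : ℕ) = 0 then 1 + coord ℝ d 0 z else 1)

lemma abs_gain_le {k : ℕ} (hk : k < d) : |a (d - 1 - k)| ≤ ∑ i ∈ Finset.range d, |a i| :=
  Finset.single_le_sum (f := fun i => |a i|) (fun i _ => abs_nonneg (a i))
    (Finset.mem_range.2 (by omega))

lemma errorDrive_zero (P : Mat n →L[ℝ] Mat n) (k : ℕ) : errorDrive d a P k 0 = 0 := by
  simp [errorDrive, matLog]

lemma exists_norm_errorDrive_sub_le (d : ℕ) (a : ℕ → ℝ) (P : Mat n →L[ℝ] Mat n) {r : ℝ}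
    (hr : r < 1) : ∃ B, 0 ≤ B ∧ ∀ k < d, ∀ z w : Fin d → Mat n, ‖coord ℝ d 0 z‖ ≤ r →
      ‖coord ℝ d 0 w‖ ≤ r → ‖errorDrive d a P k z - errorDrive d a P k w‖ ≤ B * ‖z - w‖ := by
  have hr' : 0 ≤ (1 - r)⁻¹ := inv_nonneg.2 (by linarith)
  have hS : 0 ≤ ∑ i ∈ Finset.range d, |a i| := Finset.sum_nonneg fun i _ => abs_nonneg _
  refine ⟨‖P‖ * (1 + (∑ i ∈ Finset.range d, |a i|) * (1 - r)⁻¹), by positivity,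
    fun k hk z w hz hw => ?_⟩
  rw [errorDrive, errorDrive, ← map_sub, mul_assoc]
  refine (P.le_opNorm _).trans ?_
  gcongr
  have e : coord ℝ d (k + 1) z - a (d - 1 - k) • matLog (1 + coord ℝ d 0 z)
      - (coord ℝ d (k + 1) w - a (d - 1 - k) • matLog (1 + coord ℝ d 0 w))
      = coord ℝ d (k + 1) (z - w)
        - a (d - 1 - k) • (matLog (1 + coord ℝ d 0 z) - matLog (1 + coord ℝ d 0 w)) := by
    rw [map_sub, smul_sub]; abel
  rw [e]
  refine (norm_sub_le _ _).trans ?_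
  rw [norm_smul, Real.norm_eq_abs, add_mul, one_mul, mul_assoc]
  gcongr
  · exact norm_coord_le _ _ _
  · exact abs_gain_le hk
  · refine (norm_matLog_sub_matLog_le hr hz hw).trans ?_
    rw [← map_sub]
    gcongr
    exact norm_coord_le _ _ _

lemma exists_lipschitzOnWith_errorField (d : ℕ) (a : ℕ → ℝ) (P : Mat n →L[ℝ] Mat n) {r : ℝ}
    (hr : r < 1) (R : ℝ) : ∃ K, LipschitzOnWith K (errorField d a P)
      {z | ‖coord ℝ d 0 z‖ ≤ r ∧ ‖z‖ ≤ R} := by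
  obtain ⟨B, hB, hlip⟩ := exists_norm_errorDrive_sub_le d a P hr
  refine ⟨Real.toNNReal (2 * B + B * |R|), LipschitzOnWith.of_dist_le_mul fun z hz w hw => ?_⟩
  rw [Real.coe_toNNReal _ (by positivity), dist_eq_norm, dist_eq_norm]
  refine (pi_norm_le_iff_of_nonneg (by positivity)).2 fun j => ?_
  have h1 := hlip j j.2 z w hz.1 hw.1
  have h2 : ‖errorDrive d a P j w‖ ≤ B * |R| := by
    have h := hlip j j.2 w 0 hw.1 (by simpa using (norm_nonneg _).trans hw.1)
    rw [errorDrive_zero, sub_zero, sub_zero] at h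
    exact h.trans (by gcongr; exact hw.2.trans (le_abs_self R))
  rw [Pi.sub_apply, errorField, errorField]
  split_ifs with hj
  · have e : errorDrive d a P j z * (1 + coord ℝ d 0 z)
          - errorDrive d a P j w * (1 + coord ℝ d 0 w)
        = (errorDrive d a P j z - errorDrive d a P j w) * (1 + coord ℝ d 0 z)
          + errorDrive d a P j w * coord ℝ d 0 (z - w) := by
      rw [map_sub]; noncomm_ring
    have h3 : ‖1 + coord ℝ d 0 z‖ ≤ 2 :=
      (norm_add_le _ _).trans (by linarith [norm_one_le (n := n), hz.1])
    rw [e]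
    calc _ ≤ (B * ‖z - w‖) * 2 + (B * |R|) * ‖z - w‖ := by
          refine (norm_add_le _ _).trans (add_le_add ((norm_mul_le _ _).trans ?_)
            ((norm_mul_le _ _).trans ?_))
          · gcongr
          · gcongr
            exact norm_coord_le _ _ _
      _ = _ := by ring
  · rw [mul_one, mul_one]
    refine h1.trans ?_
    gcongr
    nlinarith [mul_nonneg hB (abs_nonneg R)]

lemma exists_norm_errorField_sub_errorOperator_le (n d : ℕ) (a : ℕ → ℝ) :
    ∃ C, 0 < C ∧ ∀ z : Fin d → Mat n, ‖z‖ ≤ 1 / 2 →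
      ‖errorField d a (.id ℝ _) z - errorOperator ℝ d a z‖ ≤ C * ‖z‖ ^ 2 := by
  obtain ⟨B, hB, hlip⟩ := exists_norm_errorDrive_sub_le (n := n) d a (.id ℝ _)
    (r := 1 / 2) (by norm_num)
  set S := ∑ i ∈ Finset.range d, |a i| with hSdef
  have hS : 0 ≤ S := Finset.sum_nonneg fun i _ => abs_nonneg _
  refine ⟨B + S * 2 + 1, by positivity, fun z hz => ?_⟩
  have hz0 : ‖coord ℝ d 0 z‖ ≤ 1 / 2 := (norm_coord_le _ _ _).trans hz
  have hlog : ‖matLog (1 + coord ℝ d 0 z) - coord ℝ d 0 z‖ ≤ 2 * ‖z‖ ^ 2 := by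
    refine (norm_matLog_one_add_sub_le (by linarith)).trans ?_
    have h1 : (1 - ‖coord ℝ d 0 z‖)⁻¹ ≤ 2 := by
      rw [inv_le_comm₀ (by linarith) two_pos]; linarith
    rw [mul_comm]
    have := norm_coord_le (𝕜 := ℝ) d 0 z
    gcongr
  refine (pi_norm_le_iff_of_nonneg (by positivity)).2 fun j => ?_
  have h2 : ‖errorDrive d a (.id ℝ _) j z‖ ≤ B * ‖z‖ := by
    have h := hlip j j.2 z 0 hz0 (by simp)
    rwa [errorDrive_zero, sub_zero, sub_zero] at h
  have h3 : ‖errorDrive d a (.id ℝ _) j z - errorOperator ℝ d a z j‖ ≤ S * (2 * ‖z‖ ^ 2) := by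
    have e : errorDrive d a (.id ℝ _) j z - errorOperator ℝ d a z j
        = -(a (d - 1 - j) • (matLog (1 + coord ℝ d 0 z) - coord ℝ d 0 z)) := by
      rw [errorOperator_apply, errorDrive, smul_sub, ContinuousLinearMap.id_apply]; abel
    rw [e, norm_neg, norm_smul, Real.norm_eq_abs]
    gcongr
    exact abs_gain_le j.2
  rw [Pi.sub_apply, errorField]
  split_ifs with hj
  · rw [mul_add, mul_one, add_sub_right_comm]
    calc _ ≤ S * (2 * ‖z‖ ^ 2) + (B * ‖z‖) * ‖z‖ := by
          refine (norm_add_le _ _).trans (add_le_add h3 ((norm_mul_le _ _).trans ?_))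
          gcongr
          exact norm_coord_le _ _ _
      _ ≤ _ := by nlinarith [sq_nonneg ‖z‖]
  · rw [mul_one]
    refine h3.trans ?_
    nlinarith [mul_nonneg hB (sq_nonneg ‖z‖), sq_nonneg ‖z‖]

end ErrorField

/-! ### Solutions of the error system -/

section ErrorSolution

/-- A vector field that is Lipschitz on a ball is made bounded and globally Lipschitz by a cut-off
factor, without a change on the ball of half the radius. -/
lemma exists_cutoff {V : Type*} [NormedAddCommGroup V] [NormedSpace ℝ V] {f : V → V} {r : ℝ}
    (hr : 0 < r) {K : NNReal} (hf : LipschitzOnWith K f (closedBall 0 r)) :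
    ∃ χ : V → ℝ, (∀ z, ‖z‖ ≤ r / 2 → χ z = 1) ∧ (∀ z, r ≤ ‖z‖ → χ z = 0) ∧
      (∀ z, χ z ∈ Icc (0 : ℝ) 1) ∧ (∃ K', LipschitzWith K' fun z => χ z • f z) ∧
      ∃ L : NNReal, ∀ z, ‖χ z • f z‖ ≤ L := by
  set χ : V → ℝ := fun z => max 0 (min 1 (2 - 2 / r * ‖z‖)) with hχ
  have h01 (z : V) : χ z ∈ Icc (0 : ℝ) 1 :=
    ⟨le_max_left _ _, max_le zero_le_one (min_le_left _ _)⟩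
  have hone (z : V) (hz : ‖z‖ ≤ r / 2) : χ z = 1 := by
    have : 1 ≤ 2 - 2 / r * ‖z‖ := by
      have : 2 / r * ‖z‖ ≤ 2 / r * (r / 2) := by gcongr
      have e : 2 / r * (r / 2) = 1 := by field_simp
      linarith
    simp [hχ, this]
  have hzero (z : V) (hz : r ≤ ‖z‖) : χ z = 0 := by
    have : 2 - 2 / r * ‖z‖ ≤ 0 := by
      have : 2 / r * r ≤ 2 / r * ‖z‖ := by gcongr
      have e : 2 / r * r = 2 := by field_simp
      linarith
    exact max_eq_left ((min_le_right _ _).trans this)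
  have hχl (z w : V) : |χ z - χ w| ≤ 2 / r * ‖z - w‖ := by
    have h1 := abs_max_sub_max_le_abs (min 1 (2 - 2 / r * ‖z‖)) (min 1 (2 - 2 / r * ‖w‖)) 0
    have h2 := abs_min_sub_min_le_max 1 (2 - 2 / r * ‖z‖) 1 (2 - 2 / r * ‖w‖)
    rw [max_comm _ (0 : ℝ), max_comm _ (0 : ℝ)] at h1
    refine h1.trans (h2.trans (max_le (by simp; positivity) ?_))
    have e : 2 - 2 / r * ‖z‖ - (2 - 2 / r * ‖w‖) = 2 / r * (‖w‖ - ‖z‖) := by ring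
    rw [e, abs_mul, abs_of_pos (by positivity), norm_sub_rev]
    gcongr
    exact abs_norm_sub_norm_le _ _
  set M : ℝ := ‖f 0‖ + K * r with hM
  have hM0 : 0 ≤ M := by positivity
  have hfM (z : V) (hz : ‖z‖ ≤ r) : ‖f z‖ ≤ M := by
    have h1 := hf.dist_le_mul z (by simpa using hz) 0 (by simp [hr.le])
    rw [dist_eq_norm, dist_zero_right] at h1
    calc ‖f z‖ = ‖f 0 + (f z - f 0)‖ := by simp
      _ ≤ ‖f 0‖ + K * ‖z‖ := (norm_add_le _ _).trans (by gcongr)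
      _ ≤ M := by rw [hM]; gcongr
  refine ⟨χ, hone, hzero, h01, ⟨Real.toNNReal (K + 2 / r * M), ?_⟩, ⟨M, hM0⟩, fun z => ?_⟩
  · -- It is enough to treat a first point inside the ball.
    have main (z w : V) (hz : ‖z‖ ≤ r) :
        ‖χ z • f z - χ w • f w‖ ≤ (K + 2 / r * M) * ‖z - w‖ := by
      by_cases hw : ‖w‖ ≤ r
      · have h1 := hf.dist_le_mul z (by simpa using hz) w (by simpa using hw)
        rw [dist_eq_norm, dist_eq_norm] at h1
        have e : χ z • f z - χ w • f w = χ w • (f z - f w) + (χ z - χ w) • f z := by module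
        rw [e]
        calc _ ≤ 1 * (K * ‖z - w‖) + (2 / r * ‖z - w‖) * M := by
              refine (norm_add_le _ _).trans ?_
              rw [norm_smul, norm_smul, Real.norm_of_nonneg (h01 w).1, Real.norm_eq_abs]
              gcongr
              · exact (h01 w).2
              · exact hχl z w
              · exact hfM z hz
          _ = _ := by ring
      · have hw0 := hzero w (not_le.1 hw).le
        have h1 := hχl z w
        rw [hw0, sub_zero] at h1
        rw [hw0, zero_smul, sub_zero, norm_smul, Real.norm_eq_abs]
        calc _ ≤ (2 / r * ‖z - w‖) * M := by
              gcongr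
              exact hfM z hz
          _ ≤ _ := by
            have : 0 ≤ K * ‖z - w‖ := by positivity
            nlinarith
    refine LipschitzWith.of_dist_le_mul fun z w => ?_
    rw [Real.coe_toNNReal _ (by positivity), dist_eq_norm, dist_eq_norm]
    by_cases hz : ‖z‖ ≤ r
    · exact main z w hz
    by_cases hw : ‖w‖ ≤ r
    · rw [norm_sub_rev, norm_sub_rev z]
      exact main w z hw
    · rw [hzero z (not_le.1 hz).le, hzero w (not_le.1 hw).le]
      simp only [zero_smul, sub_zero, norm_zero]
      positivity
  · by_cases hz : ‖z‖ ≤ r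
    · rw [norm_smul, Real.norm_of_nonneg (h01 z).1]
      exact (mul_le_of_le_one_left (norm_nonneg _) (h01 z).2).trans (hfM z hz)
    · rw [hzero z (not_le.1 hz).le, zero_smul, norm_zero]
      exact hM0

lemma mem_submodule_of_hasDerivWithinAt {n : ℕ} {S : Submodule ℝ (Mat n)} {y y' : ℝ → Mat n}
    (hy : ∀ t, 0 ≤ t → HasDerivWithinAt y (y' t) (Ici 0) t) (hy' : ∀ t, 0 ≤ t → y' t ∈ S)
    (h0 : y 0 ∈ S) {t : ℝ} (ht : 0 ≤ t) : y t ∈ S := by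
  obtain ⟨P, hPm, hP⟩ := exists_continuousLinearMap_projection S
  have hd (s : ℝ) (hs : 0 ≤ s) : HasDerivWithinAt (fun s => y s - P (y s)) 0 (Ici 0) s := by
    have := (hy s hs).sub (P.hasFDerivAt.comp_hasDerivWithinAt s (hy s hs))
    exact this.congr_deriv (by rw [hP _ (hy' s hs), sub_self])
  have := constant_of_has_deriv_right_zero (a := (0 : ℝ)) (b := t)
    (fun s hs => ((hd s hs.1).continuousWithinAt).mono Icc_subset_Ici_self)
    (fun s hs => (hd s hs.1).mono (Ici_subset_Ici.2 hs.1)) t ⟨ht, le_rfl⟩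
  rw [hP _ h0, sub_self, sub_eq_zero] at this
  rw [this]
  exact hPm _

variable {n d : ℕ} {a : ℕ → ℝ}

/-- Error vectors of estimates in `G × Lie(G) × ⋯ × Lie(G)` of states in the same set. -/
def IsAdmissible (G : Subgroup (Matrix.GeneralLinearGroup (Fin n) ℝ)) (z : Fin d → Mat n) : Prop :=
  1 + coord ℝ d 0 z ∈ groupSet G ∧ ∀ k, 1 ≤ k → coord ℝ d k z ∈ lieSet G

lemma hasDerivWithinAt_coord {z : ℝ → Fin d → Mat n} {z' : Fin d → Mat n} {s : Set ℝ} {t : ℝ}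
    (h : HasDerivWithinAt z z' s t) (k : ℕ) :
    HasDerivWithinAt (fun t => coord ℝ d k (z t)) (coord ℝ d k z') s t :=
  ((coord (M := Mat n) ℝ d k).hasFDerivAt (x := z t)).comp_hasDerivWithinAt t h

/-- The error system has global solutions near the origin; they stay in
`G × Lie(G) × ⋯ × Lie(G)` and decay exponentially. They are obtained from a modified field: the
driving terms are projected to the Lie algebra, which keeps solutions in the closure of `G`, and
the field is cut off. Near the origin both modifications have no effect on points of
`G × Lie(G) × ⋯ × Lie(G)`, because there the logarithm takes values in the Lie algebra. -/
lemma exists_errorSolution (hd : 0 < d) {G : Subgroup (Matrix.GeneralLinearGroup (Fin n) ℝ)}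
    (hG : IsClosed (G : Set (Matrix.GeneralLinearGroup (Fin n) ℝ)))
    (ha : IsHurwitz (gainPolynomial d a)) :
    ∃ α > 0, ∃ δ > 0, ∃ m > 0, ∀ z₀ : Fin d → Mat n, IsAdmissible G z₀ → ‖z₀‖ < δ →
      ∃ z : ℝ → Fin d → Mat n, z 0 = z₀ ∧ ∀ t, 0 ≤ t →
        HasDerivWithinAt z (errorField d a (.id ℝ _) (z t)) (Ici 0) t ∧ IsAdmissible G (z t) ∧
        ‖z t‖ < 1 ∧ ‖z t‖ ≤ m * Real.exp (-α * t) * ‖z₀‖ := by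
  obtain ⟨P, hPm, hP⟩ := exists_continuousLinearMap_projection (lieSubmodule G hG)
  obtain ⟨N, C, β, h₀, hC, hβ, hh₀, hN1, hN2, hNA⟩ := exists_contracting_errorNorm n ha
  obtain ⟨C₂, hC₂, hquad⟩ := exists_norm_errorField_sub_errorOperator_le n d a
  obtain ⟨r₁, hr₁, hlog⟩ := Metric.eventually_nhds_iff.1 (eventually_matLog_mem_lieSet hG)
  obtain ⟨K, hK⟩ := exists_lipschitzOnWith_errorField d a P (r := 1 / 2) (by norm_num) (1 / 2)
  obtain ⟨B, hB, hdrive⟩ := exists_norm_errorDrive_sub_le d a P (r := 1 / 2) (by norm_num)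
  obtain ⟨χ, hχ1, hχ0, hχI, ⟨K', hK'⟩, L, hL⟩ := exists_cutoff (r := 1 / 2) (by norm_num)
    (hK.mono fun z (hz : z ∈ closedBall 0 (1 / 2)) => by
      have hz' : ‖z‖ ≤ 1 / 2 := by simpa using hz
      exact ⟨(norm_coord_le _ _ _).trans hz', hz'⟩)
  -- `N z < ρ` has to imply `‖z‖ < r₁`, `‖z‖ ≤ 1 / 4`, and that the remainder is at most
  -- `β / 4 * N z`; the remainder is at most `C * C₂ * ‖z‖ ^ 2` in the norm `N`.
  set ρ : ℝ := min (r₁ / C) (min (1 / 4 / C) (β / 4 / (C * C₂ * C * C))) with hρ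
  have hρ0 : 0 < ρ := by positivity
  have hsmall {x : Fin d → Mat n} (hx : N x < ρ) :
      ‖x‖ < r₁ ∧ ‖x‖ ≤ 1 / 4 ∧ C * C₂ * C * ‖x‖ ≤ β / 4 := by
    have h1 := hx.le.trans (min_le_right _ _) |>.trans (min_le_left _ _)
    have h2 := hx.le.trans (min_le_right _ _) |>.trans (min_le_right _ _)
    have h3 := hx.trans_le (min_le_left _ _)
    rw [lt_div_iff₀ hC] at h3
    rw [le_div_iff₀ hC] at h1
    rw [le_div_iff₀ (by positivity)] at h2
    have h4 := hN2 x
    refine ⟨by linarith, by linarith, ?_⟩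
    calc C * C₂ * C * ‖x‖ ≤ C * C₂ * C * (C * N x) := by gcongr
      _ ≤ _ := by linarith
  refine ⟨β / 2, by positivity, ρ / C, by positivity, C * C, by positivity, fun z₀ hz₀ hδ => ?_⟩
  obtain ⟨z, hz0, hz⟩ := exists_hasDerivWithinAt_Ici hK' hL z₀
  have hlie (k : ℕ) (hk : 1 ≤ k) {t : ℝ} (ht : 0 ≤ t) : coord ℝ d k (z t) ∈ lieSet G := by
    refine mem_submodule_of_hasDerivWithinAt (S := lieSubmodule G hG)
      (fun s hs => hasDerivWithinAt_coord (hz s hs) k) (fun s hs => ?_)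
      (by rw [hz0]; exact hz₀.2 k hk) ht
    by_cases h : k < d
    · rw [map_smul, coord_of_lt h, errorField, if_neg (by simp; omega), mul_one]
      exact Submodule.smul_mem _ _ (hPm _)
    · simp [coord, h]
  have hclosure {t : ℝ} (ht : 0 ≤ t) : 1 + coord ℝ d 0 (z t) ∈ closure (groupSet G) := by
    refine mem_closure_of_hasDerivWithinAt (E := fun t => 1 + coord ℝ d 0 (z t))
      (w := fun t => χ (z t) • errorDrive d a P 0 (z t)) (K := B * (1 / 2))
      (fun s _ => isTangent_of_mem_lieSet ((lieSubmodule G hG).smul_mem _ (hPm _)))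
      (fun s _ => ?_) (fun s hs => ?_) (by simp only [hz0]; exact hz₀.1) ht
    · by_cases h : ‖z s‖ ≤ 1 / 2
      · have h1 := hdrive 0 hd (z s) 0 ((norm_coord_le _ _ _).trans h) (by simp)
        rw [errorDrive_zero, sub_zero, sub_zero] at h1
        rw [norm_smul, Real.norm_of_nonneg (hχI _).1]
        calc _ ≤ 1 * (B * (1 / 2)) := by
              gcongr
              · exact (hχI _).2
              · exact h1.trans (by gcongr)
          _ = _ := one_mul _
      · rw [hχ0 _ (not_le.1 h).le, zero_smul, norm_zero]
        positivity
    · refine ((hasDerivWithinAt_coord (hz s hs) 0).const_add 1).congr_deriv ?_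
      rw [map_smul, coord_of_lt hd, errorField, if_pos rfl, smul_mul_assoc]
  have hgroup {t : ℝ} (ht : 0 ≤ t) (h : N (z t) < ρ) : 1 + coord ℝ d 0 (z t) ∈ groupSet G := by
    refine mem_groupSet_of_mem_closure hG (hclosure ht) ?_
    have h1 : ‖-coord ℝ d 0 (z t)‖ < 1 := by
      rw [norm_neg]
      linarith [norm_coord_le (𝕜 := ℝ) d 0 (z t), (hsmall h).2.1]
    simpa using isUnit_one_sub_of_norm_lt_one h1
  have hfield {t : ℝ} (ht : 0 ≤ t) (h : N (z t) < ρ) :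
      χ (z t) • errorField d a P (z t) = errorField d a (.id ℝ _) (z t) := by
    have hL' : matLog (1 + coord ℝ d 0 (z t)) ∈ lieSet G := by
      refine hlog ?_ (hgroup ht h)
      rw [dist_eq_norm, add_sub_cancel_left]
      exact (norm_coord_le _ _ _).trans_lt (hsmall h).1
    rw [hχ1 _ ((hsmall h).2.1.trans (by norm_num)), one_smul]
    funext j
    rw [errorField, errorField, errorDrive, errorDrive, hP, ContinuousLinearMap.id_apply]
    exact (lieSubmodule G hG).sub_mem (hlie _ (by omega) ht)
      ((lieSubmodule G hG).smul_mem _ hL')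
  have hN0 : N (z 0) < ρ := by
    rw [hz0]
    rw [lt_div_iff₀ hC] at hδ
    linarith [hN1 z₀]
  have hdecay {t : ℝ} (ht : 0 ≤ t) : N (z t) ≤ Real.exp (-(β / 2) * t) * N (z 0) := by
    refine seminorm_le_exp_mul (A := errorOperator ℝ d a)
      (r := fun s => χ (z s) • errorField d a P (z s) - errorOperator ℝ d a (z s))
      hβ hh₀ hN1 hNA (fun s hs => by simpa using hz s hs) (fun s hs h => ?_) hN0 ht
    obtain ⟨-, h2, h3⟩ := hsmall h
    simp only [hfield hs h]
    calc _ ≤ C * (C₂ * ‖z s‖ ^ 2) :=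
          (hN1 _).trans (by gcongr; exact hquad _ (by linarith))
      _ ≤ C * (C₂ * (‖z s‖ * (C * N (z s)))) := by
          rw [sq]; gcongr; exact hN2 _
      _ = (C * C₂ * C * ‖z s‖) * N (z s) := by ring
      _ ≤ _ := by
          have := apply_nonneg N (z s)
          gcongr
  refine ⟨z, hz0, fun t ht => ?_⟩
  have hNt : N (z t) < ρ := by
    refine ((hdecay ht).trans (mul_le_of_le_one_left (apply_nonneg N _) ?_)).trans_lt hN0
    exact Real.exp_le_one_iff.2 (by nlinarith)
  refine ⟨hfield ht hNt ▸ hz t ht, ⟨hgroup ht hNt, fun k hk => hlie k hk ht⟩,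
    by linarith [(hsmall hNt).2.1], ?_⟩
  calc ‖z t‖ ≤ C * (Real.exp (-(β / 2) * t) * (C * ‖z₀‖)) := by
        refine (hN2 _).trans ?_
        gcongr
        refine (hdecay ht).trans ?_
        gcongr
        rw [hz0]
        exact hN1 _
    _ = _ := by ring

/-- Two solutions of the error system on `[0, T)` with `‖z₀‖ < 1` and the same initial value
agree: on compact subintervals both stay in a set on which the field is Lipschitz. -/
lemma errorSolution_unique {T : ℝ} {z w : ℝ → Fin d → Mat n}
    (hz : ∀ t ∈ Ico 0 T, HasDerivWithinAt z (errorField d a (.id ℝ _) (z t)) (Ico 0 T) t)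
    (hw : ∀ t ∈ Ico 0 T, HasDerivWithinAt w (errorField d a (.id ℝ _) (w t)) (Ico 0 T) t)
    (hz1 : ∀ t ∈ Ico 0 T, ‖coord ℝ d 0 (z t)‖ < 1) (hw1 : ∀ t ∈ Ico 0 T, ‖coord ℝ d 0 (w t)‖ < 1)
    (h0 : z 0 = w 0) {t : ℝ} (ht : t ∈ Ico 0 T) : z t = w t := by
  have hsub : Icc 0 t ⊆ Ico 0 T := fun s hs => ⟨hs.1, hs.2.trans_lt ht.2⟩
  have bounds (y : ℝ → Fin d → Mat n)
      (hy : ∀ t ∈ Ico 0 T, HasDerivWithinAt y (errorField d a (.id ℝ _) (y t)) (Ico 0 T) t)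
      (hy1 : ∀ t ∈ Ico 0 T, ‖coord ℝ d 0 (y t)‖ < 1) :
      ContinuousOn y (Icc 0 t) ∧
      (∀ s ∈ Ico 0 t, HasDerivWithinAt y (errorField d a (.id ℝ _) (y s)) (Ici s) s) ∧
      ∃ r < 1, ∃ R, ∀ s ∈ Icc 0 t, ‖coord ℝ d 0 (y s)‖ ≤ r ∧ ‖y s‖ ≤ R := by
    have hc : ContinuousOn y (Icc 0 t) := fun s hs =>
      ((hy s (hsub hs)).continuousWithinAt).mono hsub
    refine ⟨hc, fun s hs => ?_, ?_⟩
    · have hs' : s ∈ Ico 0 T := hsub (Ico_subset_Icc_self hs)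
      refine (hy s hs').mono_of_mem_nhdsWithin ?_
      filter_upwards [self_mem_nhdsWithin, nhdsWithin_le_nhds (gt_mem_nhds hs'.2)] with q h1 h2
      exact ⟨hs.1.trans h1, h2⟩
    · obtain ⟨s, hs, hmax⟩ := isCompact_Icc.exists_isMaxOn ⟨0, le_rfl, ht.1⟩
        ((coord ℝ d 0).continuous.norm.comp_continuousOn hc)
      obtain ⟨R, hR⟩ := isCompact_Icc.exists_bound_of_continuousOn hc
      exact ⟨_, hy1 s (hsub hs), R, fun q hq => ⟨hmax hq, hR q hq⟩⟩
  obtain ⟨hzc, hzd, r₁, hr₁, R₁, hb₁⟩ := bounds z hz hz1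
  obtain ⟨hwc, hwd, r₂, hr₂, R₂, hb₂⟩ := bounds w hw hw1
  obtain ⟨K, hK⟩ := exists_lipschitzOnWith_errorField (n := n) d a (.id ℝ _)
    (max_lt hr₁ hr₂) (max R₁ R₂)
  exact ODE_solution_unique_of_mem_Icc_right (v := fun _ => errorField d a (.id ℝ _))
    (fun _ _ => hK) hzc hzd
    (fun s hs => ⟨(hb₁ s (Ico_subset_Icc_self hs)).1.trans (le_max_left _ _),
      (hb₁ s (Ico_subset_Icc_self hs)).2.trans (le_max_left _ _)⟩) hwc hwd
    (fun s hs => ⟨(hb₂ s (Ico_subset_Icc_self hs)).1.trans (le_max_right _ _),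
      (hb₂ s (Ico_subset_Icc_self hs)).2.trans (le_max_right _ _)⟩) h0 ⟨ht.1, le_rfl⟩

end ErrorSolution

/-! ### From the error system to the observer -/

section Observer

variable {n d : ℕ} {a : ℕ → ℝ}

/-- The vector `(X⁻¹ Xh - 1, xh₂ - x₂, …, xh_d - x_d)`. The coordinate `xh_i - x_i` has
index `i - 1`. -/
noncomputable def errorVector (d : ℕ) (X : Mat n) (x : ℕ → Mat n) (Xh : Mat n) (xh : ℕ → Mat n) :
    Fin d → Mat n :=
  fun j => if (j : ℕ) = 0 then X⁻¹ * Xh - 1 else xh (j + 1) - x (j + 1)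

lemma coord_zero_errorVector (hd : 0 < d) (X : Mat n) (x : ℕ → Mat n) (Xh : Mat n)
    (xh : ℕ → Mat n) : coord ℝ d 0 (errorVector d X x Xh xh) = X⁻¹ * Xh - 1 := by
  rw [coord_of_lt hd, errorVector, if_pos rfl]

lemma coord_errorVector {k : ℕ} (hk : 0 < k) (hkd : k < d) (X : Mat n) (x : ℕ → Mat n)
    (Xh : Mat n) (xh : ℕ → Mat n) :
    coord ℝ d k (errorVector d X x Xh xh) = xh (k + 1) - x (k + 1) := by
  rw [coord_of_lt hkd, errorVector, if_neg hk.ne']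

lemma norm_errorVector_le (X : Mat n) (x : ℕ → Mat n) (Xh : Mat n) (xh : ℕ → Mat n) :
    ‖errorVector d X x Xh xh‖ ≤ groupError d X x Xh xh := by
  have hs : ∀ i ∈ Finset.Icc 2 d, 0 ≤ ‖x i - xh i‖ := fun _ _ => norm_nonneg _
  have hs0 := Finset.sum_nonneg hs
  refine (pi_norm_le_iff_of_nonneg (by unfold groupError; positivity)).2 fun j => ?_
  rw [errorVector, groupError]
  split_ifs with hj
  · linarith
  · rw [norm_sub_rev]
    have := Finset.single_le_sum hs
      (Finset.mem_Icc.2 ⟨by omega, j.2⟩ : (j : ℕ) + 1 ∈ Finset.Icc 2 d)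
    linarith [norm_nonneg (X⁻¹ * Xh - 1)]

lemma groupError_le (hd : 0 < d) (X : Mat n) (x : ℕ → Mat n) (Xh : Mat n) (xh : ℕ → Mat n) :
    groupError d X x Xh xh ≤ d * ‖errorVector d X x Xh xh‖ := by
  have h1 : ‖X⁻¹ * Xh - 1‖ ≤ ‖errorVector d X x Xh xh‖ := by
    rw [← coord_zero_errorVector hd X x Xh xh]
    exact norm_coord_le _ _ _
  have h2 : ∑ i ∈ Finset.Icc 2 d, ‖x i - xh i‖ ≤
      (Finset.Icc 2 d).card • ‖errorVector d X x Xh xh‖ := by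
    refine Finset.sum_le_card_nsmul _ _ _ fun i hi => ?_
    obtain ⟨hi1, hi2⟩ := Finset.mem_Icc.1 hi
    have := coord_errorVector (d := d) (k := i - 1) (by omega) (by omega) X x Xh xh
    rw [show i - 1 + 1 = i by omega] at this
    rw [norm_sub_rev, ← this]
    exact norm_coord_le _ _ _
  have h3 : ((Finset.Icc 2 d).card : ℝ) = d - 1 := by
    rw [Nat.card_Icc, show d + 1 - 2 = d - 1 by omega, Nat.cast_sub hd, Nat.cast_one]
  rw [nsmul_eq_mul, h3] at h2
  rw [groupError]
  linarith

lemma hasDerivWithinAt_inv_mat {X : ℝ → Mat n} {X' : Mat n} {s : Set ℝ} {t : ℝ}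
    (hX : HasDerivWithinAt X X' s t) (hu : IsUnit (X t)) :
    HasDerivWithinAt (fun t => (X t)⁻¹) (-((X t)⁻¹ * X' * (X t)⁻¹)) s t := by
  obtain ⟨v, hv⟩ := hu
  have h1 := hasFDerivAt_ringInverse (𝕜 := ℝ) v
  rw [hv] at h1
  have h2 := h1.comp_hasDerivWithinAt t hX
  have e : (↑v⁻¹ : Mat n) = (X t)⁻¹ := by rw [← hv, Matrix.coe_units_inv]
  simp only [Function.comp_def, ← Matrix.nonsing_inv_eq_ringInverse] at h2
  exact h2.congr_deriv (by simp [e])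

/-- Along a trajectory of the system, the error vector of a solution of the observer solves the
error system, which depends neither on the trajectory nor on the input. -/
lemma hasDerivWithinAt_errorVector (hd : 2 ≤ d)
    {G : Subgroup (Matrix.GeneralLinearGroup (Fin n) ℝ)} {u X : ℝ → Mat n} {x : ℕ → ℝ → Mat n}
    (hX : IsPlantTrajectory G d u X x) {J : Set ℝ} (hJ : J ⊆ Ici 0) {Xh : ℝ → Mat n}
    {xh : ℕ → ℝ → Mat n} (hXh : IsDirectObserverOn J d a X u Xh xh) {t : ℝ} (ht : t ∈ J) :
    HasDerivWithinAt (fun t => errorVector d (X t) (fun i => x i t) (Xh t) fun i => xh i t)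
      (errorField d a (.id ℝ _) (errorVector d (X t) (fun i => x i t) (Xh t) fun i => xh i t))
      J t := by
  have ht0 : 0 ≤ t := hJ ht
  have hXt := hX.mem_group t ht0
  have hinv := inv_mul_cancel_of_mem_groupSet hXt
  refine hasDerivWithinAt_pi.2 fun j => ?_
  rw [errorField, errorDrive, coord_zero_errorVector (by omega), add_sub_cancel,
    ContinuousLinearMap.id_apply]
  by_cases hj : (j : ℕ) = 0
  · simp only [errorVector, hj, if_true]
    rw [coord_errorVector (by omega) (by omega)]
    have h1 := hasDerivWithinAt_inv_mat ((hX.deriv_group t ht0).mono hJ)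
      (isUnit_of_mem_groupSet hXt)
    refine ((h1.mul (hXh.deriv_group t ht)).sub_const 1).congr_deriv ?_
    have hcomm := matLog_mul_comm (hXh.mem_ball t ht)
    set L := matLog ((X t)⁻¹ * Xh t)
    have e1 : (X t)⁻¹ * (X t * x 2 t) * (X t)⁻¹ * Xh t = x 2 t * ((X t)⁻¹ * Xh t) := by
      rw [← mul_assoc (X t)⁻¹ (X t), hinv, one_mul, mul_assoc]
    have e2 : (X t)⁻¹ * (X t * xh 2 t * (X t)⁻¹ * Xh t - a (d - 1) • (Xh t * L))
        = xh 2 t * ((X t)⁻¹ * Xh t) - a (d - 1) • (L * ((X t)⁻¹ * Xh t)) := by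
      rw [hcomm, mul_sub, mul_smul_comm]
      simp only [← mul_assoc]
      rw [hinv, one_mul]
    rw [e2, neg_mul, e1]
    simp only [Nat.sub_zero, zero_add, Nat.reduceAdd, sub_mul, smul_mul_assoc]
    abel
  · simp only [errorVector, hj, if_false, mul_one]
    have hj1 := j.2
    by_cases hjd : (j : ℕ) + 1 < d
    · rw [coord_errorVector (by omega) hjd]
      have h1 := (hXh.deriv_lie (j + 1) (by omega) hjd t ht).sub
        ((hX.deriv_lie (j + 1) (by omega) hjd t ht0).mono hJ)
      refine h1.congr_deriv ?_
      rw [show d - 1 - (j : ℕ) = d - (j + 1) by omega]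
      abel
    · have hjd' : (j : ℕ) + 1 = d := by omega
      rw [hjd', coord_self, show d - 1 - (j : ℕ) = 0 by omega]
      have h1 := (hXh.deriv_last t ht).sub ((hX.deriv_last t ht0).mono hJ)
      refine h1.congr_deriv ?_
      abel

/-- Conversely, a solution of the error system yields a solution of the observer, which is its
response to the initial estimate with the given initial error. -/
lemma isObserverResponse_of_errorSolution (hd : 2 ≤ d)
    {G : Subgroup (Matrix.GeneralLinearGroup (Fin n) ℝ)}
    (hG : IsClosed (G : Set (Matrix.GeneralLinearGroup (Fin n) ℝ))) {u X : ℝ → Mat n}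
    {x : ℕ → ℝ → Mat n} (hX : IsPlantTrajectory G d u X x) {Xh0 : Mat n} {xh0 : ℕ → Mat n}
    {z : ℝ → Fin d → Mat n} (hz0 : z 0 = errorVector d (X 0) (fun i => x i 0) Xh0 xh0)
    (hz : ∀ t, 0 ≤ t → HasDerivWithinAt z (errorField d a (.id ℝ _) (z t)) (Ici 0) t)
    (hadm : ∀ t, 0 ≤ t → IsAdmissible G (z t)) (hlt : ∀ t, 0 ≤ t → ‖z t‖ < 1) :
    IsObserverResponse G d a X u Xh0 xh0 (fun t => X t * (1 + coord ℝ d 0 (z t)))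
      (fun i t => x i t + coord ℝ d (i - 1) (z t)) := by
  have hinv {t : ℝ} (ht : 0 ≤ t) := inv_mul_cancel_of_mem_groupSet (hX.mem_group t ht)
  have hinv' {t : ℝ} (ht : 0 ≤ t) := mul_inv_cancel_of_mem_groupSet (hX.mem_group t ht)
  have hE {t : ℝ} (ht : 0 ≤ t) : (X t)⁻¹ * (X t * (1 + coord ℝ d 0 (z t)))
      = 1 + coord ℝ d 0 (z t) := by
    rw [← mul_assoc, hinv ht, one_mul]
  have hz0lt {t : ℝ} (ht : 0 ≤ t) : ‖coord ℝ d 0 (z t)‖ < 1 :=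
    (norm_coord_le _ _ _).trans_lt (hlt t ht)
  have hball {t : ℝ} (ht : 0 ≤ t) : ‖1 + coord ℝ d 0 (z t) - 1‖ < 1 := by
    rw [add_sub_cancel_left]; exact hz0lt ht
  -- The coordinate `i - 1` of the error field, for `2 ≤ i ≤ d`.
  have hcoord {i : ℕ} (h2 : 2 ≤ i) (hid : i ≤ d) {t : ℝ} (ht : 0 ≤ t) :
      HasDerivWithinAt (fun t => coord ℝ d (i - 1) (z t))
        (coord ℝ d i (z t) - a (d - i) • matLog (1 + coord ℝ d 0 (z t))) (Ici 0) t := by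
    refine (hasDerivWithinAt_coord (hz t ht) (i - 1)).congr_deriv ?_
    rw [coord_of_lt (show i - 1 < d by omega), errorField, if_neg (by simp; omega), mul_one,
      errorDrive, ContinuousLinearMap.id_apply]
    simp only [show i - 1 + 1 = i by omega, show d - 1 - (i - 1) = d - i by omega]
  refine
    { solution :=
        { mem_ball := fun t ht => by rw [hE ht]; exact hball ht
          deriv_group := fun t ht => ?_
          deriv_lie := fun i h2 hid t ht => ?_
          deriv_last := fun t ht => ?_ }
      mem_group := fun t ht => mul_mem_groupSet (hX.mem_group t ht) (hadm t ht).1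
      mem_lie := fun i h2 hid t ht => (lieSubmodule G hG).add_mem (hX.mem_lie i h2 hid t ht)
        ((hadm t ht).2 _ (by omega))
      init_group := ?_
      init_lie := fun i h2 hid => ?_
      unique := fun T Zh zh hsol hZ0 hzh0 t ht => ?_ }
  · have h1 := (hX.deriv_group t ht).mul ((hasDerivWithinAt_coord (hz t ht) 0).const_add 1)
    refine h1.congr_deriv ?_
    rw [hE ht, coord_of_lt (show 0 < d by omega) (errorField _ _ _ _), errorField, if_pos rfl,
      errorDrive, ContinuousLinearMap.id_apply]
    have hcomm := matLog_mul_comm (hball ht)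
    simp only [zero_add, Nat.sub_zero, show 2 - 1 = 1 from rfl]
    set L := matLog (1 + coord ℝ d 0 (z t))
    set E := 1 + coord ℝ d 0 (z t)
    have e1 : X t * (x 2 t + coord ℝ d 1 (z t)) * (X t)⁻¹ * (X t * E)
        = X t * (x 2 t + coord ℝ d 1 (z t)) * E := by
      rw [mul_assoc _ (X t)⁻¹, ← mul_assoc (X t)⁻¹, hinv ht, one_mul]
    rw [e1, mul_assoc (X t) E L, ← hcomm]
    simp only [mul_add, add_mul, mul_sub, sub_mul, smul_mul_assoc, mul_smul_comm, mul_assoc]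
    abel
  · rw [hE ht]
    refine ((hX.deriv_lie i h2 hid t ht).add (hcoord h2 hid.le ht)).congr_deriv ?_
    rw [show i + 1 - 1 = i by omega]
    abel
  · rw [hE ht]
    refine ((hX.deriv_last t ht).add (hcoord hd le_rfl ht)).congr_deriv ?_
    rw [coord_self, Nat.sub_self]
    abel
  · rw [hz0, coord_zero_errorVector (by omega), add_sub_cancel, ← mul_assoc, hinv' le_rfl, one_mul]
  · rw [hz0, coord_errorVector (by omega) (by omega), show i - 1 + 1 = i by omega]
    abel
  · have hw0 (t : ℝ) (ht : t ∈ Ico 0 T) : ‖coord ℝ d 0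
        (errorVector d (X t) (fun i => x i t) (Zh t) fun i => zh i t)‖ < 1 := by
      rw [coord_zero_errorVector (by omega)]
      exact hsol.mem_ball t ht
    have h00 : z 0 = errorVector d (X 0) (fun i => x i 0) (Zh 0) fun i => zh i 0 := by
      rw [hz0]
      funext j
      by_cases hj : (j : ℕ) = 0
      · simp [errorVector, hj, hZ0]
      · have := hzh0 (j + 1) (by omega) j.2
        simp [errorVector, hj, this]
    have heq := errorSolution_unique
      (fun t ht => (hz t ht.1).mono Ico_subset_Ici_self)
      (fun t ht => hasDerivWithinAt_errorVector hd hX Ico_subset_Ici_self hsol ht)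
      (fun t ht => hz0lt ht.1) hw0 h00 ht
    rw [heq]
    refine ⟨?_, fun i h2 hid => ?_⟩
    · rw [coord_zero_errorVector (by omega), add_sub_cancel, ← mul_assoc, hinv' ht.1, one_mul]
    · rw [coord_errorVector (by omega) (by omega), show i - 1 + 1 = i by omega]
      abel

lemma exists_locallyExpStabilizes (hd : 2 ≤ d)
    {G : Subgroup (Matrix.GeneralLinearGroup (Fin n) ℝ)}
    (hG : IsClosed (G : Set (Matrix.GeneralLinearGroup (Fin n) ℝ)))
    (ha : IsHurwitz (gainPolynomial d a)) : ∃ α > 0, LocallyExpStabilizes G d a α := by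
  obtain ⟨α, hα, δ, hδ, m, hm, hsol⟩ := exists_errorSolution (by omega) hG ha
  have hd0 : (0 : ℝ) < d := by exact_mod_cast (by omega : 0 < d)
  refine ⟨α, hα, δ, hδ, d * m, by positivity, fun u _ X x hX Xh0 xh0 hXh0 hxh0 hsmall => ?_⟩
  set z₀ := errorVector d (X 0) (fun i => x i 0) Xh0 xh0 with hz₀
  have hnorm : ‖z₀‖ ≤ groupError d (X 0) (fun i => x i 0) Xh0 xh0 := norm_errorVector_le _ _ _ _
  have hadm : IsAdmissible G z₀ := by
    refine ⟨?_, fun k hk => ?_⟩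
    · rw [coord_zero_errorVector (by omega), add_sub_cancel]
      exact mul_mem_groupSet (inv_mem_groupSet (hX.mem_group 0 le_rfl)) hXh0
    · by_cases h : k < d
      · rw [coord_errorVector (by omega) h]
        exact (lieSubmodule G hG).sub_mem (hxh0 _ (by omega) h)
          (hX.mem_lie _ (by omega) h 0 le_rfl)
      · rw [coord, dif_neg h]
        exact (lieSubmodule G hG).zero_mem
  obtain ⟨z, hz0, hz⟩ := hsol z₀ hadm (hnorm.trans_lt hsmall)
  refine ⟨_, _, isObserverResponse_of_errorSolution hd hG hX hz0 (fun t ht => (hz t ht).1)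
    (fun t ht => (hz t ht).2.1) (fun t ht => (hz t ht).2.2.1), fun t ht => ?_⟩
  have hvec : errorVector d (X t) (fun i => x i t) (X t * (1 + coord ℝ d 0 (z t)))
      (fun i => x i t + coord ℝ d (i - 1) (z t)) = z t := by
    funext j
    rw [errorVector]
    split_ifs with hj
    · rw [← mul_assoc, inv_mul_cancel_of_mem_groupSet (hX.mem_group t ht), one_mul,
        add_sub_cancel_left, coord_of_lt (show 0 < d by omega)]
      congr 1
      exact Fin.ext hj.symm
    · rw [add_sub_cancel_left, Nat.add_sub_cancel, coord_of_lt j.2]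
  refine (groupError_le (by omega) _ _ _ _).trans ?_
  rw [hvec, mul_assoc (d : ℝ) m, mul_assoc]
  gcongr
  exact (hz t ht).2.2.2.trans (by gcongr)

/-- If `X` is bounded, then the two error measures are comparable along the trajectory:
`Xh - X = X (X⁻¹ Xh - 1)`. -/
lemma LocallyExpStabilizes.solvesEstimation
    {G : Subgroup (Matrix.GeneralLinearGroup (Fin n) ℝ)} {α : ℝ}
    (h : LocallyExpStabilizes G d a α) {u : ℝ → Mat n} (hu : IsInput G u)
    (hb : BoundedResponse G d u) : SolvesEstimation G d a α u := by
  obtain ⟨δ, hδ, m, hm, hstab⟩ := h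
  intro X x hX
  obtain ⟨K, hK⟩ := hb X x hX
  have hK0 : 0 ≤ K := (norm_nonneg _).trans (hK 0 le_rfl)
  set κ : ℝ := ‖(X 0)⁻¹‖ + 1 with hκ
  have hκ0 : 0 < κ := by positivity
  refine ⟨δ / κ, by positivity, (K + 1) * (m * κ), by positivity,
    fun Xh0 xh0 hXh0 hxh0 hsmall => ?_⟩
  have hge : groupError d (X 0) (fun i => x i 0) Xh0 xh0 ≤
      κ * estimationError d (X 0) (fun i => x i 0) Xh0 xh0 := by
    have e : (X 0)⁻¹ * Xh0 - 1 = (X 0)⁻¹ * (Xh0 - X 0) := by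
      rw [mul_sub, inv_mul_cancel_of_mem_groupSet (hX.mem_group 0 le_rfl)]
    rw [groupError, estimationError, mul_add, e]
    simp only [norm_sub_rev (x _ 0)]
    refine add_le_add ((norm_mul_le _ _).trans (by gcongr; linarith)) ?_
    exact le_mul_of_one_le_left (Finset.sum_nonneg fun _ _ => norm_nonneg _)
      (by linarith [norm_nonneg (X 0)⁻¹])
  obtain ⟨Xh, xh, hresp, hdecay⟩ := hstab u hu X x hX Xh0 xh0 hXh0 hxh0
    (hge.trans_lt (by rwa [lt_div_iff₀' hκ0] at hsmall))
  refine ⟨Xh, xh, hresp, fun t ht => ?_⟩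
  have heg : estimationError d (X t) (fun i => x i t) (Xh t) (fun i => xh i t) ≤
      (K + 1) * groupError d (X t) (fun i => x i t) (Xh t) (fun i => xh i t) := by
    have e : Xh t - X t = X t * ((X t)⁻¹ * Xh t - 1) := by
      rw [mul_sub, ← mul_assoc, mul_inv_cancel_of_mem_groupSet (hX.mem_group t ht), one_mul,
        mul_one]
    rw [groupError, estimationError, mul_add, e]
    simp only [norm_sub_rev (x _ t)]
    refine add_le_add ((norm_mul_le _ _).trans ?_) ?_
    · gcongr
      linarith [hK t ht]
    · exact le_mul_of_one_le_left (Finset.sum_nonneg fun _ _ => norm_nonneg _) (by linarith)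
  calc _ ≤ (K + 1) * (m * Real.exp (-α * t) *
        (κ * estimationError d (X 0) (fun i => x i 0) Xh0 xh0)) := by
        refine heg.trans ?_
        gcongr
        refine (hdecay t ht).trans ?_
        gcongr
    _ = _ := by ring

end Observer

end PartialStateObserver

theorem mainTheorem3 (n d : ℕ) (hd : 2 ≤ d)
    (G : Subgroup (Matrix.GeneralLinearGroup (Fin n) ℝ))
    (hG : IsClosed (G : Set (Matrix.GeneralLinearGroup (Fin n) ℝ)))
    (a : ℕ → ℝ)
    (ha : PartialStateObserver.IsHurwitz (PartialStateObserver.gainPolynomial d a)) :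
    ∃ α : ℝ, 0 < α ∧
      PartialStateObserver.LocallyExpStabilizes G d a α ∧
      ∀ u : ℝ → PartialStateObserver.Mat n, PartialStateObserver.IsInput G u →
        PartialStateObserver.BoundedResponse G d u →
        PartialStateObserver.SolvesEstimation G d a α u := by
  obtain ⟨α, hα, h⟩ := PartialStateObserver.exists_locallyExpStabilizes hd hG ha
  exact ⟨α, hα, h, fun u hu hb => h.solvesEstimation hu hb⟩
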